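/- Let $H$ be a separable real Hilbert space, $T\in(0,\infty)$, let $(\Omega,\mathcal F,\mathbb P)$ be a probability space with a normal filtration $(\mathbb F_t)_{t\in[0,T]}$ (right-continuous, and every $\mathbb F_t$ contains all $\mathbb P$-null events), and let $(W_t)_{t\in[0,T]}$ be an $\mathrm{Id}_H$-cylindrical $(\mathbb F_t)$-Wiener process. Let $\mathbb H\subseteq H$ be a non-empty orthonormal basis of $H$, let $\lambda\colon\mathbb H\to\mathbb R$ satisfy $\sup_{h\in\mathbb H}\lambda_h<0$, and let $A$ be the diagonal operator $Av=\sum_{h\in\mathbb H}\lambda_h\langle h,v\rangle_H h$ with domain $D(A)=\{v\in H:\sum_{h\in\mathbb H}|\lambda_h\langle h,v\rangle_H|^2<\infty\}$. For $r\in\mathbb R$ let $H_r$ be the interpolation space associated to $-A$, that is, the Hilbert space of all (formal) series $u=\sum_{h\in\mathbb H}u_h h$ with $\|u\|_{H_r}^2=\sum_{h\in\mathbb H}|\lambda_h|^{2r}|u_h|^2<\infty$ (so $H_0=H$, and $A$ acts on these series by $u_h\mapsto\lambda_hu_h$), and let $\mathbf H_r=H_{r/2}\times H_{r/2-1/2}$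 with the Hilbert space product norm. For $I\subseteq\mathbb H$ let $P_I u=\sum_{h\in I}u_h h$ and $\mathbf P_I(v,w)=(P_Iv,P_Iw)$. Let $\mathbf A\colon D(\mathbf A)=\mathbf H_1\subseteq\mathbf H_0\to\mathbf H_0$ be the operator $\mathbf A(v,w)=(w,Av)$, and let $(e^{t\mathbf A})_{t\ge0}$ be the strongly continuous semigroup on $\mathbf H_0$ generated by $\mathbf A$. Let $\mu\colon\mathbb H\to\mathbb R$ satisfy $\sum_{h\in\mathbb H}|\mu_h|^2/|\lambda_h|<\infty$, and let $\mathbf B\colon H\to\mathbf H_0$ be the Hilbert--Schmidt operator $\mathbf Bv=\bigl(0,\sum_{h\in\mathbb H}\mu_h\langle h,v\rangle_H h\bigr)$. For every $I\subseteq\mathbb H$ let $\mathbf X^I\colon\Omega\to\mathbf P_I(\mathbf H_0)$ be a random variable with $$\mathbf X^I=\int_0^T e^{(T-s)\mathbf A}\,\mathbf P_I\mathbf B\,dW_s\qquad\mathbb P\text{-a.s.}$$ Assume $\inf_{h\in\mathbb H}|\mu_h|>0$. Then $\mathbf X^I\in L^2(\mathbb P;\mathbf H_0)$ for every $I\subseteq\mathbb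 H$, and for every proper subset $I\subsetneq\mathbb H$ the series $\sum_{h\in\mathbb H\setminus I}1/|\lambda_h|$ converges and $$\mathbb E\bigl[\|\mathbf X^{\mathbb H}\|_{\mathbf H_0}^2\bigr]-\mathbb E\bigl[\|\mathbf X^{I}\|_{\mathbf H_0}^2\bigr]=\mathbb E\bigl[\|\mathbf X^{\mathbb H\setminus I}\|_{\mathbf H_0}^2\bigr]\ \ge\ T\,\inf_{h\in\mathbb H}|\mu_h|^2\sum_{h\in\mathbb H\setminus I}\frac1{|\lambda_h|}\ >\ 0 .$$ -/

import Mathlib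

open MeasureTheory ProbabilityTheory Filter Topology
open scoped ENNReal NNReal InnerProductSpace

noncomputable section

/-! ### Diagonal operators and their interpolation spaces -/

/-- The vector space of all families of real numbers indexed by `ι`, without any topology. All the
spaces `H_r` below are subspaces of it; a vector is identified with its family of coordinates with
respect to the orthonormal basis. -/
def CoordFamily (ι : Type*) : Type _ := ι → ℝ

namespace CoordFamily
variable {ι : Type*}

instance : AddCommGroup (CoordFamily ι) := inferInstanceAs (AddCommGroup (ι → ℝ))
instance : Module ℝ (CoordFamily ι) := inferInstanceAs (Module ℝ (ι → ℝ))
instance : CoeFun (CoordFamily ι) fun _ => ι → ℝ := ⟨fun u => u⟩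

/-- A family of reals, regarded as an element of `CoordFamily ι`. -/
def of (f : ι → ℝ) : CoordFamily ι := f
@[simp] theorem of_apply (f : ι → ℝ) (i : ι) : of f i = f i := rfl

@[ext] theorem ext {u v : CoordFamily ι} (h : ∀ i, u i = v i) : u = v := funext h
@[simp] theorem zero_apply (i : ι) : (0 : CoordFamily ι) i = 0 := rfl
@[simp] theorem add_apply (u v : CoordFamily ι) (i : ι) : (u + v) i = u i + v i := rfl
@[simp] theorem neg_apply (u : CoordFamily ι) (i : ι) : (-u) i = -u i := rfl
@[simp] theorem sub_apply (u v : CoordFamily ι) (i : ι) : (u - v) i = u i - v i := rfl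
@[simp] theorem smul_apply (c : ℝ) (u : CoordFamily ι) (i : ι) : (c • u) i = c * u i := rfl

/-- Multiplication of the coordinates by a fixed family of reals. -/
def diag (a : ι → ℝ) : CoordFamily ι →ₗ[ℝ] CoordFamily ι where
  toFun u := of fun i => a i * u i
  map_add' u v := by ext i; simp [mul_add]
  map_smul' c u := by ext i; simp [mul_left_comm]

@[simp] theorem diag_apply (a : ι → ℝ) (u : CoordFamily ι) (i : ι) :
    diag a u i = a i * u i := rfl

/-- The projection `P_I`: keep the coordinates in `I`, delete all others. -/
def proj (I : Set ι) : CoordFamily ι →ₗ[ℝ] CoordFamily ι := diag (I.indicator fun _ => 1)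

end CoordFamily

/-- An orthonormal basis `(e_h)` of `H` together with real eigenvalues `(λ_h)` such that
`sup_h λ_h < 0`. (With Mathlib's conventions the supremum of an empty or unbounded family of reals
is `0`, so the last condition entails that the basis is non-empty and that `λ` is bounded above.) -/
structure NegDiagonal (ι H : Type*) [NormedAddCommGroup H] [InnerProductSpace ℝ H] where
  basis : HilbertBasis ι ℝ H
  eig : ι → ℝ
  iSup_eig_neg : (⨆ h, eig h) < 0

namespace NegDiagonal

variable {ι H : Type*} [NormedAddCommGroup H] [InnerProductSpace ℝ H] (D : NegDiagonal ι H)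

theorem eig_neg (h : ι) : D.eig h < 0 := by
  have hb : BddAbove (Set.range D.eig) := by
    by_contra hb
    have := D.iSup_eig_neg
    rw [Real.iSup_of_not_bddAbove hb] at this
    exact lt_irrefl _ this
  exact (le_ciSup hb h).trans_lt D.iSup_eig_neg

theorem abs_eig_pos (h : ι) : 0 < |D.eig h| := abs_pos.2 (D.eig_neg h).ne

/-- The coordinates `(⟨e_h, v⟩)_h` of a vector `v` of `H`. -/
def coord : H →ₗ[ℝ] CoordFamily ι where
  toFun v := .of fun h => ⟪D.basis h, v⟫_ℝ
  map_add' u v := by ext h; exact inner_add_right _ _ _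
  map_smul' c u := by ext h; exact real_inner_smul_right _ _ _

@[simp] theorem coord_apply (v : H) (h : ι) : D.coord v h = ⟪D.basis h, v⟫_ℝ := rfl

/-- The diagonal operator `A e_h = λ_h e_h`, in coordinates. -/
def opA : CoordFamily ι →ₗ[ℝ] CoordFamily ι := CoordFamily.diag D.eig

/-- On vectors of `H`, `opA` is `A v = ∑ λ_h ⟨e_h, v⟩ e_h` whenever this series converges. -/
theorem opA_coord {v w : H} (hw : HasSum (fun h => (D.eig h * ⟪D.basis h, v⟫_ℝ) • D.basis h) w) :
    D.opA (D.coord v) = D.coord w := by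
  classical
  ext k
  have h1 := hw.mapL (innerSL ℝ (D.basis k))
  have h2 : HasSum (fun h => if h = k then D.eig k * ⟪D.basis k, v⟫_ℝ else 0)
      ⟪D.basis k, w⟫_ℝ := by
    refine h1.congr_fun fun h => ?_
    rw [innerSL_apply_apply, real_inner_smul_right,
      orthonormal_iff_ite.1 D.basis.orthonormal k h]
    by_cases hk : h = k
    · subst hk
      simp
    · simp [hk, Ne.symm hk]
  exact (hasSum_ite_eq k _).unique h2

/-- The interpolation space `H_r` associated to `-A`: all `u = ∑ u_h e_h` for which the squared
norm of `(-A)^r u`, that is `∑ (|λ_h| ^ r u_h) ^ 2`, is finite. For `r ≥ 0` this is the domain of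
`(-A)^r`, for `r < 0` it is the completion of `H` with respect to the norm of `(-A)^r u`. -/
def Hs (r : ℝ) : Submodule ℝ (CoordFamily ι) where
  carrier := {u | Summable fun h => (|D.eig h| ^ r * u h) ^ 2}
  zero_mem' := by simp [summable_zero]
  add_mem' {u v} hu hv := by
    refine Summable.of_nonneg_of_le (fun h => sq_nonneg _) (fun h => ?_)
      ((hu.mul_left 2).add (hv.mul_left 2))
    simp only [CoordFamily.add_apply]
    nlinarith [sq_nonneg (|D.eig h| ^ r * u h - |D.eig h| ^ r * v h)]
  smul_mem' c u hu := by
    refine (Summable.mul_left (c ^ 2) hu).congr fun h => ?_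
    simp only [CoordFamily.smul_apply]
    ring

theorem mem_Hs {r : ℝ} {u : CoordFamily ι} :
    u ∈ D.Hs r ↔ Summable fun h => (|D.eig h| ^ r * u h) ^ 2 := Iff.rfl

/-- The map `(-A)^r` from `H_r` to square-summable families. -/
def HsToLp (r : ℝ) : D.Hs r →ₗ[ℝ] lp (fun _ : ι => ℝ) 2 where
  toFun u := ⟨fun h => |D.eig h| ^ r * u.1 h, by
    refine memℓp_gen ?_
    refine (D.mem_Hs.1 u.2).congr fun h => ?_
    simp [mul_pow]⟩
  map_add' u v := by
    ext h
    exact mul_add _ _ _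
  map_smul' c u := by
    ext h
    exact mul_left_comm _ _ _

@[simp] theorem HsToLp_apply (r : ℝ) (u : D.Hs r) (h : ι) :
    D.HsToLp r u h = |D.eig h| ^ r * u.1 h := rfl

theorem HsToLp_injective (r : ℝ) : Function.Injective (D.HsToLp r) := by
  intro u v huv
  ext h
  have := congrArg (fun f : lp (fun _ : ι => ℝ) 2 => f h) huv
  simpa [(Real.rpow_pos_of_pos (D.abs_eig_pos h) r).ne'] using this

theorem HsToLp_surjective (r : ℝ) : Function.Surjective (D.HsToLp r) := by
  intro f
  have hpos := fun h => (Real.rpow_pos_of_pos (D.abs_eig_pos h) r).ne'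
  have hf : ∀ h, |D.eig h| ^ r * ((|D.eig h| ^ r)⁻¹ * f h) = f h := fun h => by
    rw [← mul_assoc, mul_inv_cancel₀ (hpos h), one_mul]
  refine ⟨⟨.of fun h => (|D.eig h| ^ r)⁻¹ * f h, ?_⟩, ?_⟩
  · rw [mem_Hs]
    simp only [CoordFamily.of_apply, hf]
    have := (lp.memℓp f).summable (by norm_num)
    exact this.congr fun h => by simp
  · ext h
    simp [hf]

/-- `‖u‖_{H_r} = ‖(-A)^r u‖`. -/
instance (r : ℝ) : NormedAddCommGroup (D.Hs r) :=
  NormedAddCommGroup.induced _ _ (D.HsToLp r) (D.HsToLp_injective r)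

theorem norm_def (r : ℝ) (u : D.Hs r) : ‖u‖ = ‖D.HsToLp r u‖ := rfl

/-- `⟨u, v⟩_{H_r} = ⟨(-A)^r u, (-A)^r v⟩`. -/
instance (r : ℝ) : InnerProductSpace ℝ (D.Hs r) where
  norm_smul_le c u := by
    rw [norm_def, norm_def, map_smul]
    exact norm_smul_le _ _
  inner u v := ⟪D.HsToLp r u, D.HsToLp r v⟫_ℝ
  norm_sq_eq_re_inner u := by
    rw [norm_def]
    exact InnerProductSpace.norm_sq_eq_re_inner (𝕜 := ℝ) _
  conj_inner_symm u v := inner_conj_symm (𝕜 := ℝ) _ _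
  add_left u v w := by
    rw [map_add]
    exact inner_add_left _ _ _
  smul_left u v c := by
    rw [map_smul]
    exact inner_smul_left _ _ _

theorem inner_eq (r : ℝ) (u v : D.Hs r) :
    ⟪u, v⟫_ℝ = ∑' h, (|D.eig h| ^ r * u.1 h) * (|D.eig h| ^ r * v.1 h) := by
  change ⟪D.HsToLp r u, D.HsToLp r v⟫_ℝ = _
  rw [lp.inner_eq_tsum]
  refine tsum_congr fun h => ?_
  simp [mul_comm]

theorem norm_sq_eq (r : ℝ) (u : D.Hs r) : ‖u‖ ^ 2 = ∑' h, (|D.eig h| ^ r * u.1 h) ^ 2 := by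
  rw [← real_inner_self_eq_norm_sq, inner_eq]
  exact tsum_congr fun h => (sq _).symm

/-- `(-A)^r` is an isometric isomorphism from `H_r` onto the square-summable families. -/
def HsEquivLp (r : ℝ) : D.Hs r ≃ₗᵢ[ℝ] lp (fun _ : ι => ℝ) 2 where
  toLinearEquiv := LinearEquiv.ofBijective (D.HsToLp r)
    ⟨D.HsToLp_injective r, D.HsToLp_surjective r⟩
  norm_map' _ := rfl

instance (r : ℝ) : CompleteSpace (D.Hs r) :=
  (D.HsEquivLp r).toIsometryEquiv.completeSpace

theorem coord_mem (v : H) : D.coord v ∈ D.Hs 0 := by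
  rw [mem_Hs]
  refine (D.basis.summable_inner_mul_inner v v).congr fun h => ?_
  simp [sq, real_inner_comm v]

/-- `H_0` is `H`: taking coordinates is an isometric isomorphism. -/
theorem exists_equiv_H : ∃ e : H ≃ₗᵢ[ℝ] D.Hs 0, ∀ v h, (e v).1 h = ⟪D.basis h, v⟫_ℝ := by
  refine ⟨D.basis.repr.trans (D.HsEquivLp 0).symm, fun v h => ?_⟩
  obtain ⟨u, hu⟩ : ∃ u, u = (D.HsEquivLp 0).symm (D.basis.repr v) := ⟨_, rfl⟩
  have h2 : D.HsToLp 0 u = D.basis.repr v := by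
    rw [hu]
    exact (D.HsEquivLp 0).apply_symm_apply _
  have h1 : |D.eig h| ^ (0 : ℝ) * u.1 h = ⟪D.basis h, v⟫_ℝ := by
    rw [← D.basis.repr_apply_apply, ← h2]
    rfl
  simp only [Real.rpow_zero, one_mul] at h1
  rw [← h1, hu]
  rfl

/-! ### The wave operator -/

/-- The Hilbert space `𝐇_r = H_{r/2} × H_{r/2-1/2}`. -/
abbrev Wv (r : ℝ) : Type _ := WithLp 2 (D.Hs (r / 2) × D.Hs (r / 2 - 1 / 2))

theorem opA_mem {u : CoordFamily ι} {r : ℝ} (hu : u ∈ D.Hs r) : D.opA u ∈ D.Hs (r - 1) := by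
  rw [mem_Hs] at hu ⊢
  refine hu.congr fun h => ?_
  have hp := D.abs_eig_pos h
  have h1 : |D.eig h| ^ r = |D.eig h| ^ (r - 1) * |D.eig h| := by
    rw [← Real.rpow_add_one hp.ne', sub_add_cancel]
  rw [opA, CoordFamily.diag_apply, h1, mul_pow, mul_pow, mul_pow, mul_pow, sq_abs]
  ring

/-- The coordinates of the first component. -/
def fstCoord (r : ℝ) : D.Wv r →ₗ[ℝ] CoordFamily ι :=
  (D.Hs (r / 2)).subtype ∘ₗ WithLp.fstₗ 2 ℝ _ _

/-- The coordinates of the second component. -/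
def sndCoord (r : ℝ) : D.Wv r →ₗ[ℝ] CoordFamily ι :=
  (D.Hs (r / 2 - 1 / 2)).subtype ∘ₗ WithLp.sndₗ 2 ℝ _ _

theorem fstCoord_apply {r : ℝ} (x : D.Wv r) : D.fstCoord r x = x.fst.1 := rfl
theorem sndCoord_apply {r : ℝ} (x : D.Wv r) : D.sndCoord r x = x.snd.1 := rfl

/-- The linear map `x ↦ (L₁ x, L₂ x)` into `𝐇_r`, given in coordinates. -/
def pairMap {M : Type*} [AddCommGroup M] [Module ℝ M] (r : ℝ) (L₁ L₂ : M →ₗ[ℝ] CoordFamily ι)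
    (h₁ : ∀ x, L₁ x ∈ D.Hs (r / 2)) (h₂ : ∀ x, L₂ x ∈ D.Hs (r / 2 - 1 / 2)) : M →ₗ[ℝ] D.Wv r :=
  (WithLp.linearEquiv 2 ℝ _).symm.toLinearMap ∘ₗ
    (L₁.codRestrict (D.Hs (r / 2)) h₁).prod (L₂.codRestrict (D.Hs (r / 2 - 1 / 2)) h₂)

section pairMap
variable {M : Type*} [AddCommGroup M] [Module ℝ M] {r : ℝ} {L₁ L₂ : M →ₗ[ℝ] CoordFamily ι}
  (h₁ : ∀ x, L₁ x ∈ D.Hs (r / 2)) (h₂ : ∀ x, L₂ x ∈ D.Hs (r / 2 - 1 / 2))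

@[simp] theorem fstCoord_pairMap (x : M) : D.fstCoord r (D.pairMap r L₁ L₂ h₁ h₂ x) = L₁ x := rfl
@[simp] theorem sndCoord_pairMap (x : M) : D.sndCoord r (D.pairMap r L₁ L₂ h₁ h₂ x) = L₂ x := rfl
end pairMap

theorem norm_sq_wave {r : ℝ} (x : D.Wv r) : ‖x‖ ^ 2 =
    ∑' h, (|D.eig h| ^ (r / 2) * D.fstCoord r x h) ^ 2 +
      ∑' h, (|D.eig h| ^ (r / 2 - 1 / 2) * D.sndCoord r x h) ^ 2 := by
  rw [WithLp.prod_norm_sq_eq_of_L2, norm_sq_eq, norm_sq_eq]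
  rfl

theorem fstCoord_mem {r : ℝ} (x : D.Wv r) : D.fstCoord r x ∈ D.Hs (r / 2) := x.fst.2
theorem sndCoord_mem {r : ℝ} (x : D.Wv r) : D.sndCoord r x ∈ D.Hs (r / 2 - 1 / 2) := x.snd.2

theorem exists_wave {r : ℝ} {u v : CoordFamily ι} (hu : u ∈ D.Hs (r / 2))
    (hv : v ∈ D.Hs (r / 2 - 1 / 2)) : ∃ x : D.Wv r, D.fstCoord r x = u ∧ D.sndCoord r x = v :=
  ⟨WithLp.toLp 2 (⟨u, hu⟩, ⟨v, hv⟩), rfl, rfl⟩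

/-- The domain `𝐇_1` of the wave operator, as a subspace of `𝐇_0`. -/
def waveDomain : Submodule ℝ (D.Wv 0) :=
  (D.Hs (1 / 2)).comap (D.fstCoord 0) ⊓ (D.Hs (1 / 2 - 1 / 2)).comap (D.sndCoord 0)

theorem mem_waveDomain {x : D.Wv 0} : x ∈ D.waveDomain ↔
    D.fstCoord 0 x ∈ D.Hs (1 / 2) ∧ D.sndCoord 0 x ∈ D.Hs (1 / 2 - 1 / 2) := Iff.rfl

/-- The wave operator `𝐀 (v, w) = (w, A v)` on `𝐇_0` with domain `D(𝐀) = 𝐇_1`. -/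
def waveOp : D.Wv 0 →ₗ.[ℝ] D.Wv 0 where
  domain := D.waveDomain
  toFun := D.pairMap 0 (D.sndCoord 0 ∘ₗ D.waveDomain.subtype)
    (D.opA ∘ₗ D.fstCoord 0 ∘ₗ D.waveDomain.subtype)
    (fun x => by
      have := (D.mem_waveDomain.1 x.2).2
      norm_num at this ⊢
      exact this)
    (fun x => by
      have := D.opA_mem (D.mem_waveDomain.1 x.2).1
      norm_num at this ⊢
      exact this)

theorem waveOp_fst (x : D.waveOp.domain) :
    D.fstCoord 0 (D.waveOp x) = D.sndCoord 0 x.1 := D.fstCoord_pairMap _ _ _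
theorem waveOp_snd (x : D.waveOp.domain) :
    D.sndCoord 0 (D.waveOp x) = D.opA (D.fstCoord 0 x.1) := D.sndCoord_pairMap _ _ _

end NegDiagonal

/-! ### Strongly continuous semigroups -/

/-- `S t`, `t ≥ 0`, is the strongly continuous semigroup `e^{tA}` generated by the (unbounded)
operator `A`: the graph of `A` consists of all `(x, y)` such that `(S t x - x) / t → y` as
`t` decreases to `0`. Negative times are irrelevant. -/
structure IsC0SemigroupGeneratedBy {V : Type*} [NormedAddCommGroup V] [NormedSpace ℝ V]
    (S : ℝ → V →L[ℝ] V) (A : V →ₗ.[ℝ] V) : Prop where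
  zero : S 0 = ContinuousLinearMap.id ℝ V
  add : ∀ s t, 0 ≤ s → 0 ≤ t → S (s + t) = (S s).comp (S t)
  cont : ∀ x, ContinuousOn (fun t => S t x) (Set.Ici 0)
  generator : ∀ x y, (x, y) ∈ A.graph ↔
    Tendsto (fun t : ℝ => t⁻¹ • (S t x - x)) (𝓝[>] 0) (𝓝 y)

namespace NegDiagonal

variable {ι H : Type*} [NormedAddCommGroup H] [InnerProductSpace ℝ H] (D : NegDiagonal ι H)

/-- The coordinates `v_h + i w_h / |λ_h| ^ (1/2)` of `(v, w)` in `𝐇_0`; auxiliary, only used to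
show that the wave operator generates a semigroup. -/
def cx (x : D.Wv 0) (h : ι) : ℂ :=
  ⟨D.fstCoord 0 x h, (|D.eig h| ^ (1 / 2 : ℝ))⁻¹ * D.sndCoord 0 x h⟩

theorem cx_sub (x y : D.Wv 0) (h : ι) : D.cx (x - y) h = D.cx x h - D.cx y h := by
  apply Complex.ext <;> simp [cx, mul_sub]

theorem cx_add (x y : D.Wv 0) (h : ι) : D.cx (x + y) h = D.cx x h + D.cx y h := by
  apply Complex.ext <;> simp [cx, mul_add]

theorem cx_smul (c : ℝ) (x : D.Wv 0) (h : ι) : D.cx (c • x) h = c * D.cx x h := by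
  apply Complex.ext <;> simp [cx, mul_left_comm]

theorem rpow_half_pos (h : ι) : 0 < |D.eig h| ^ (1 / 2 : ℝ) :=
  Real.rpow_pos_of_pos (D.abs_eig_pos h) _

theorem norm_cx_sq (x : D.Wv 0) (h : ι) : ‖D.cx x h‖ ^ 2 =
    (|D.eig h| ^ (0 / 2 : ℝ) * D.fstCoord 0 x h) ^ 2 +
      (|D.eig h| ^ (0 / 2 - 1 / 2 : ℝ) * D.sndCoord 0 x h) ^ 2 := by
  rw [← Complex.normSq_eq_norm_sq, Complex.normSq_apply, cx]
  have : |D.eig h| ^ (0 / 2 - 1 / 2 : ℝ) = (|D.eig h| ^ (1 / 2 : ℝ))⁻¹ := by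
    rw [← Real.rpow_neg (abs_nonneg _)]
    norm_num
  rw [this]
  simp [sq]

theorem hasSum_norm_cx_sq (x : D.Wv 0) : HasSum (fun h => ‖D.cx x h‖ ^ 2) (‖x‖ ^ 2) := by
  simp only [norm_cx_sq]
  rw [norm_sq_wave]
  exact (D.mem_Hs.1 (D.fstCoord_mem x)).hasSum.add (D.mem_Hs.1 (D.sndCoord_mem x)).hasSum

theorem cx_injective {x y : D.Wv 0} (hxy : ∀ h, D.cx x h = D.cx y h) : x = y := by
  have h1 := D.hasSum_norm_cx_sq (x - y)
  simp only [cx_sub, hxy, sub_self, norm_zero, ne_eq, OfNat.ofNat_ne_zero, not_false_eq_true,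
    zero_pow] at h1
  have := h1.unique hasSum_zero
  rwa [sq_eq_zero_iff, norm_eq_zero, sub_eq_zero] at this

theorem norm_cx_le (x : D.Wv 0) (h : ι) : ‖D.cx x h‖ ≤ ‖x‖ := by
  have := le_hasSum (D.hasSum_norm_cx_sq x) h fun _ _ => sq_nonneg _
  exact le_of_sq_le_sq this (norm_nonneg _)

theorem exists_cx_eq (f : ι → ℂ) (hf : Summable fun h => ‖f h‖ ^ 2) :
    ∃ x : D.Wv 0, ∀ h, D.cx x h = f h := by
  have h1 : CoordFamily.of (fun h => (f h).re) ∈ D.Hs (0 / 2) := by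
    rw [mem_Hs]
    refine Summable.of_nonneg_of_le (fun h => sq_nonneg _) (fun h => ?_) hf
    simp only [zero_div, Real.rpow_zero, one_mul, CoordFamily.of_apply]
    rw [← sq_abs]
    exact pow_le_pow_left₀ (abs_nonneg _) (Complex.abs_re_le_norm _) 2
  have h2 : CoordFamily.of (fun h => |D.eig h| ^ (1 / 2 : ℝ) * (f h).im) ∈
      D.Hs (0 / 2 - 1 / 2) := by
    rw [mem_Hs]
    refine Summable.of_nonneg_of_le (fun h => sq_nonneg _) (fun h => ?_) hf
    rw [CoordFamily.of_apply, ← mul_assoc, ← Real.rpow_add (D.abs_eig_pos h)]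
    norm_num
    rw [← sq_abs]
    exact pow_le_pow_left₀ (abs_nonneg _) (Complex.abs_im_le_norm _) 2
  obtain ⟨x, hx1, hx2⟩ := D.exists_wave h1 h2
  refine ⟨x, fun h => ?_⟩
  rw [cx, hx1, hx2, CoordFamily.of_apply, CoordFamily.of_apply,
    inv_mul_cancel_left₀ (D.rpow_half_pos h).ne']

theorem cx_waveOp (x : D.waveOp.domain) (h : ι) :
    D.cx (D.waveOp x) h = -(|D.eig h| ^ (1 / 2 : ℝ) : ℝ) * Complex.I * D.cx x.1 h := by
  have h0 := (D.rpow_half_pos h).ne'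
  have h1 : D.eig h = -(|D.eig h| ^ (1 / 2 : ℝ) * |D.eig h| ^ (1 / 2 : ℝ)) := by
    rw [← Real.rpow_add (D.abs_eig_pos h)]
    norm_num [abs_of_neg (D.eig_neg h)]
  simp only [cx, waveOp_fst, waveOp_snd, opA, CoordFamily.diag_apply]
  generalize D.fstCoord 0 x.1 h = p
  generalize D.sndCoord 0 x.1 h = q
  generalize |D.eig h| ^ (1 / 2 : ℝ) = k at h0 h1
  rw [h1]
  apply Complex.ext
  · simp [mul_inv_cancel_left₀ h0]
  · simp
    field_simp

theorem mem_waveDomain_of_cx {x y : D.Wv 0}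
    (hxy : ∀ h, D.cx y h = -(|D.eig h| ^ (1 / 2 : ℝ) : ℝ) * Complex.I * D.cx x h) :
    x ∈ D.waveDomain := by
  have hs := (D.hasSum_norm_cx_sq y).summable
  rw [mem_waveDomain]
  constructor
  · rw [mem_Hs]
    refine Summable.of_nonneg_of_le (fun h => sq_nonneg _) (fun h => ?_) hs
    have := Complex.abs_im_le_norm (D.cx y h)
    rw [← sq_abs]
    refine pow_le_pow_left₀ (abs_nonneg _) (le_trans (le_of_eq ?_) this) 2
    rw [hxy]
    simp [cx]
  · rw [mem_Hs]
    refine Summable.of_nonneg_of_le (fun h => sq_nonneg _) (fun h => ?_) hs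
    have := Complex.abs_re_le_norm (D.cx y h)
    rw [← sq_abs]
    refine pow_le_pow_left₀ (abs_nonneg _) (le_trans (le_of_eq ?_) this) 2
    have h0 := (D.rpow_half_pos h).ne'
    rw [hxy, sub_self, Real.rpow_zero, one_mul]
    simp only [cx]
    generalize |D.eig h| ^ (1 / 2 : ℝ) = k at h0
    simp [-abs_mul, mul_inv_cancel_left₀ h0]

/-- The wave operator generates a strongly continuous semigroup. -/
theorem exists_semigroup :
    ∃ S : ℝ → D.Wv 0 →L[ℝ] D.Wv 0, IsC0SemigroupGeneratedBy S D.waveOp := by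
  have hnorm : ∀ (t : ℝ) (h : ι),
      ‖Complex.exp (t * (-(|D.eig h| ^ (1 / 2 : ℝ) : ℝ) * Complex.I))‖ = 1 := fun t h => by
    have : (t : ℂ) * (-(|D.eig h| ^ (1 / 2 : ℝ) : ℝ) * Complex.I) =
        ((t * -(|D.eig h| ^ (1 / 2 : ℝ)) : ℝ) : ℂ) * Complex.I := by
      push_cast
      ring
    rw [this, Complex.norm_exp_ofReal_mul_I]
  have hex : ∀ (t : ℝ) (x : D.Wv 0), ∃ y : D.Wv 0, ∀ h, D.cx y h =
      Complex.exp (t * (-(|D.eig h| ^ (1 / 2 : ℝ) : ℝ) * Complex.I)) * D.cx x h := fun t x =>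
    D.exists_cx_eq _ ((D.hasSum_norm_cx_sq x).summable.congr fun h => by
      rw [norm_mul, hnorm, one_mul])
  choose U hU using hex
  have hUn : ∀ t x, ‖U t x‖ = ‖x‖ := fun t x => by
    have h1 := D.hasSum_norm_cx_sq (U t x)
    simp only [hU, norm_mul, hnorm, one_mul] at h1
    exact (pow_left_inj₀ (norm_nonneg _) (norm_nonneg _) two_ne_zero).1
      (h1.unique (D.hasSum_norm_cx_sq x))
  let S : ℝ → D.Wv 0 →L[ℝ] D.Wv 0 := fun t => LinearMap.mkContinuous
    { toFun := U t
      map_add' := fun x y => D.cx_injective fun h => by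
        rw [cx_add, hU, hU, hU, cx_add, mul_add]
      map_smul' := fun c x => D.cx_injective fun h => by
        rw [RingHom.id_apply, cx_smul, hU, hU, cx_smul, mul_left_comm] } 1
    fun x => by simp [hUn]
  have hS : ∀ t x h, D.cx (S t x) h =
      Complex.exp (t * (-(|D.eig h| ^ (1 / 2 : ℝ) : ℝ) * Complex.I)) * D.cx x h :=
    fun t x h => hU t x h
  -- convergence in `𝐇_0` from dominated convergence of coordinates
  have hconv : ∀ {l : Filter ℝ} (f : ℝ → D.Wv 0) (y : D.Wv 0) (b : ι → ℝ), Summable b →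
      (∀ h, Tendsto (fun t => D.cx (f t) h) l (𝓝 (D.cx y h))) →
      (∀ᶠ t in l, ∀ h, ‖D.cx (f t) h - D.cx y h‖ ^ 2 ≤ b h) → Tendsto f l (𝓝 y) := by
    intro l f y b hb h1 h2
    have h3 : Tendsto (fun t => ∑' h, ‖D.cx (f t) h - D.cx y h‖ ^ 2) l (𝓝 (∑' _ : ι, (0 : ℝ))) := by
      refine tendsto_tsum_of_dominated_convergence hb (fun h => ?_) ?_
      · have := (((h1 h).sub_const (D.cx y h)).norm).pow 2
        simpa using this
      · filter_upwards [h2] with t ht h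
        rw [Real.norm_of_nonneg (sq_nonneg _)]
        exact ht h
    have h4 : ∀ t, ∑' h, ‖D.cx (f t) h - D.cx y h‖ ^ 2 = ‖f t - y‖ ^ 2 := fun t => by
      rw [← (D.hasSum_norm_cx_sq (f t - y)).tsum_eq]
      simp only [cx_sub]
    simp only [h4, tsum_zero] at h3
    rw [tendsto_iff_norm_sub_tendsto_zero]
    have := h3.sqrt
    simpa [Real.sqrt_sq (norm_nonneg _)] using this
  refine ⟨S, ⟨?_, ?_, ?_, ?_⟩⟩
  · ext1 x
    refine D.cx_injective fun h => ?_
    rw [hS]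
    simp
  · intro s t _ _
    ext1 x
    refine D.cx_injective fun h => ?_
    rw [ContinuousLinearMap.comp_apply, hS, hS, hS, Complex.ofReal_add, add_mul,
      Complex.exp_add, mul_assoc]
  · intro x
    refine Continuous.continuousOn (continuous_iff_continuousAt.2 fun t => ?_)
    refine hconv _ _ (fun h => 4 * ‖D.cx x h‖ ^ 2)
      ((D.hasSum_norm_cx_sq x).summable.mul_left 4) (fun h => ?_) (.of_forall fun s h => ?_)
    · simp only [hS]
      have : Continuous fun s : ℝ =>
          Complex.exp (s * (-(|D.eig h| ^ (1 / 2 : ℝ) : ℝ) * Complex.I)) * D.cx x h := by fun_prop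
      exact this.tendsto t
    · have : ‖D.cx (S s x) h - D.cx (S t x) h‖ ≤ 2 * ‖D.cx x h‖ := by
        refine (norm_sub_le _ _).trans (le_of_eq ?_)
        rw [hS, hS, norm_mul, norm_mul, hnorm, hnorm]
        ring
      calc _ ≤ (2 * ‖D.cx x h‖) ^ 2 := pow_le_pow_left₀ (norm_nonneg _) this 2
        _ = _ := by ring
  · have hder : ∀ x h, Tendsto (fun t : ℝ => D.cx (t⁻¹ • (S t x - x)) h) (𝓝[>] 0)
        (𝓝 (-(|D.eig h| ^ (1 / 2 : ℝ) : ℝ) * Complex.I * D.cx x h)) := by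
      intro x h
      have h1 : HasDerivAt (fun t : ℝ =>
          Complex.exp (t * (-(|D.eig h| ^ (1 / 2 : ℝ) : ℝ) * Complex.I)) * D.cx x h)
          (-(|D.eig h| ^ (1 / 2 : ℝ) : ℝ) * Complex.I * D.cx x h) 0 := by
        have := (((Complex.ofRealCLM.hasDerivAt (x := (0 : ℝ))).mul_const
          (-(|D.eig h| ^ (1 / 2 : ℝ) : ℝ) * Complex.I)).cexp).mul_const (D.cx x h)
        simpa using this
      have h2 := h1.tendsto_slope_zero_right
      refine h2.congr fun t => ?_
      rw [cx_smul, cx_sub, hS]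
      simp
    intro x y
    constructor
    · intro hxy
      obtain ⟨x', hx', rfl⟩ := (LinearPMap.mem_graph_iff _).1 hxy
      simp only at hx'
      subst hx'
      refine hconv _ _ (fun h => 4 * ‖D.cx (D.waveOp x') h‖ ^ 2)
        ((D.hasSum_norm_cx_sq _).summable.mul_left 4) (fun h => ?_) ?_
      · rw [cx_waveOp]
        exact hder _ _
      · filter_upwards [self_mem_nhdsWithin] with t ht h
        have ht : 0 < t := ht
        have h1 : ‖Complex.exp (t * (-(|D.eig h| ^ (1 / 2 : ℝ) : ℝ) * Complex.I)) - 1‖ ≤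
            t * |D.eig h| ^ (1 / 2 : ℝ) := by
          have := Real.norm_exp_I_mul_ofReal_sub_one_le (x := -(t * |D.eig h| ^ (1 / 2 : ℝ)))
          rw [norm_neg, Real.norm_of_nonneg (mul_nonneg ht.le (D.rpow_half_pos h).le)] at this
          refine le_trans (le_of_eq ?_) this
          congr 3
          push_cast
          ring
        have h2 : ‖D.cx (t⁻¹ • (S t x'.1 - x'.1)) h‖ ≤ ‖D.cx (D.waveOp x') h‖ := by
          rw [cx_smul, cx_sub, hS, cx_waveOp]
          have : Complex.exp (t * (-(|D.eig h| ^ (1 / 2 : ℝ) : ℝ) * Complex.I)) * D.cx x'.1 h -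
            D.cx x'.1 h = (Complex.exp (t * (-(|D.eig h| ^ (1 / 2 : ℝ) : ℝ) * Complex.I)) - 1) *
              D.cx x'.1 h := by ring
          rw [this, norm_mul, norm_mul, norm_mul, norm_mul, norm_neg, Complex.norm_I, mul_one,
            Complex.norm_real, Complex.norm_real, Real.norm_of_nonneg (inv_nonneg.2 ht.le),
            Real.norm_of_nonneg (D.rpow_half_pos h).le, ← mul_assoc]
          gcongr
          calc _ ≤ t⁻¹ * (t * |D.eig h| ^ (1 / 2 : ℝ)) := by gcongr
            _ = _ := inv_mul_cancel_left₀ ht.ne' _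
        have h3 := (norm_sub_le (D.cx (t⁻¹ • (S t x'.1 - x'.1)) h) (D.cx (D.waveOp x') h))
        calc _ ≤ (2 * ‖D.cx (D.waveOp x') h‖) ^ 2 :=
              pow_le_pow_left₀ (norm_nonneg _) (by linarith) 2
          _ = _ := by ring
    · intro hxy
      have h1 : ∀ h, D.cx y h = -(|D.eig h| ^ (1 / 2 : ℝ) : ℝ) * Complex.I * D.cx x h := by
        intro h
        refine tendsto_nhds_unique ?_ (hder x h)
        rw [tendsto_iff_norm_sub_tendsto_zero] at hxy ⊢
        refine squeeze_zero (fun _ => norm_nonneg _) (fun t => ?_) hxy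
        rw [← cx_sub]
        exact D.norm_cx_le _ _
      refine (LinearPMap.mem_graph_iff _).2 ⟨⟨x, D.mem_waveDomain_of_cx h1⟩, rfl, ?_⟩
      refine D.cx_injective fun h => ?_
      rw [cx_waveOp, h1]

/-- The strongly continuous semigroup `e^{t𝐀}`, `t ≥ 0`, generated by the wave operator. (A strongly
continuous semigroup is determined by its generator, so this is well defined for `t ≥ 0`.) -/
def waveExp : ℝ → D.Wv 0 →L[ℝ] D.Wv 0 := Classical.choose D.exists_semigroup

theorem waveExp_spec : IsC0SemigroupGeneratedBy D.waveExp D.waveOp :=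
  Classical.choose_spec D.exists_semigroup

/-! ### Projections and the noise operator -/

theorem proj_mem (I : Set ι) {r : ℝ} {u : CoordFamily ι} (hu : u ∈ D.Hs r) :
    CoordFamily.proj I u ∈ D.Hs r := by
  rw [mem_Hs] at hu ⊢
  refine Summable.of_nonneg_of_le (fun h => sq_nonneg _) (fun h => ?_) hu
  by_cases hI : h ∈ I
  · simp [CoordFamily.proj, hI]
  · simp [CoordFamily.proj, hI, sq_nonneg]

/-- The projection `P_I` on `H_r`. -/
def projHs (I : Set ι) (r : ℝ) : D.Hs r →L[ℝ] D.Hs r :=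
  LinearMap.mkContinuous (LinearMap.codRestrict (D.Hs r) (CoordFamily.proj I ∘ₗ (D.Hs r).subtype)
    fun u => D.proj_mem I u.2) 1 fun u => by
      rw [one_mul]
      refine le_of_sq_le_sq ?_ (norm_nonneg _)
      rw [norm_sq_eq, norm_sq_eq]
      refine Summable.tsum_le_tsum (fun h => ?_) (D.proj_mem I u.2) u.2
      by_cases hI : h ∈ I
      · simp [CoordFamily.proj, hI]
      · simp [CoordFamily.proj, hI, sq_nonneg]

theorem projHs_coe (I : Set ι) (r : ℝ) (u : D.Hs r) :
    (D.projHs I r u).1 = CoordFamily.proj I u.1 := rfl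

open Classical in
/-- The unit vector `|λ_h|^{-r} e_h` of `H_r`. -/
def unitHs (r : ℝ) (h : ι) : D.Hs r := (D.HsEquivLp r).symm (lp.single 2 h 1)

open Classical in
theorem unitHs_coe (r : ℝ) (h : ι) :
    (D.unitHs r h).1 = .of fun k => if k = h then |D.eig h| ^ (-r) else 0 := by
  have h1 : D.HsToLp r (D.unitHs r h) = lp.single 2 h 1 :=
    (D.HsEquivLp r).apply_symm_apply _
  ext k
  have h2 : |D.eig k| ^ r * (D.unitHs r h).1 k = (lp.single 2 h (1 : ℝ) : lp (fun _ => ℝ) 2) k := by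
    rw [← h1]
    rfl
  have h3 := Real.rpow_pos_of_pos (D.abs_eig_pos k) r
  rw [CoordFamily.of_apply]
  split_ifs with hk
  · subst hk
    simp only [lp.single_apply_self] at h2
    rw [Real.rpow_neg (abs_nonneg _)]
    exact eq_inv_of_mul_eq_one_right h2
  · simp [hk] at h2
    rcases h2 with h2 | h2
    · exact absurd h2 h3.ne'
    · exact h2

/-- `P_I u = ∑_{h ∈ I} ⟨|λ_h|^{-r} e_h, u⟩_{H_r} |λ_h|^{-r} e_h`. -/
theorem hasSum_projHs (I : Set ι) (r : ℝ) (u : D.Hs r) :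
    HasSum (fun h : I => ⟪D.unitHs r h, u⟫_ℝ • D.unitHs r h) (D.projHs I r u) := by
  classical
  have h1 := lp.hasSum_single (p := 2) (by norm_num) (D.HsToLp r (D.projHs I r u))
  have h2 := h1.mapL ((D.HsEquivLp r).symm.toContinuousLinearEquiv : _ →L[ℝ] D.Hs r)
  have h3 : (D.HsEquivLp r).symm (D.HsToLp r (D.projHs I r u)) = D.projHs I r u :=
    (D.HsEquivLp r).symm_apply_apply _
  have h4 : ∀ h, ⟪D.unitHs r h, u⟫_ℝ = |D.eig h| ^ r * u.1 h := fun h => by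
    have h5 : D.HsToLp r (D.unitHs r h) = lp.single 2 h 1 :=
      (D.HsEquivLp r).apply_symm_apply _
    change ⟪D.HsToLp r (D.unitHs r h), D.HsToLp r u⟫_ℝ = _
    rw [h5, lp.inner_single_left]
    simp
  refine (hasSum_subtype_iff_indicator
    (f := fun h => ⟪D.unitHs r h, u⟫_ℝ • D.unitHs r h) (s := I)).2 ?_
  rw [← h3]
  refine h2.congr_fun fun h => ?_
  have h6 : (D.HsEquivLp r).symm (lp.single 2 h (D.HsToLp r (D.projHs I r u) h)) =
      D.HsToLp r (D.projHs I r u) h • D.unitHs r h := by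
    rw [unitHs, ← map_smul, ← lp.single_smul]
    simp
  change _ = (D.HsEquivLp r).symm (lp.single 2 h (D.HsToLp r (D.projHs I r u) h))
  rw [h6, HsToLp_apply, projHs_coe]
  by_cases hI : h ∈ I
  · rw [Set.indicator_of_mem hI, h4]
    simp [CoordFamily.proj, hI]
  · rw [Set.indicator_of_notMem hI]
    simp [CoordFamily.proj, hI]

/-- The projection `𝐏_I (v, w) = (P_I v, P_I w)` on `𝐇_r`. -/
def projWv (I : Set ι) (r : ℝ) : D.Wv r →L[ℝ] D.Wv r :=
  (WithLp.prodContinuousLinearEquiv 2 ℝ _ _).symm.toContinuousLinearMap ∘L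
    ((D.projHs I (r / 2)).prodMap (D.projHs I (r / 2 - 1 / 2))) ∘L
      (WithLp.prodContinuousLinearEquiv 2 ℝ _ _).toContinuousLinearMap

theorem fstCoord_projWv (I : Set ι) (r : ℝ) (x : D.Wv r) :
    D.fstCoord r (D.projWv I r x) = CoordFamily.proj I (D.fstCoord r x) := rfl
theorem sndCoord_projWv (I : Set ι) (r : ℝ) (x : D.Wv r) :
    D.sndCoord r (D.projWv I r x) = CoordFamily.proj I (D.sndCoord r x) := rfl

theorem noise_bound {μ : ι → ℝ} (hμ : Summable fun h => |μ h| ^ 2 / |D.eig h|) (v : H) (h : ι) :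
    (|D.eig h| ^ (0 / 2 - 1 / 2 : ℝ) * CoordFamily.diag μ (D.coord v) h) ^ 2 ≤
      (∑' k, |μ k| ^ 2 / |D.eig k|) * ⟪D.basis h, v⟫_ℝ ^ 2 := by
  have h1 : (|D.eig h| ^ (0 / 2 - 1 / 2 : ℝ)) ^ 2 = 1 / |D.eig h| := by
    have h3 : (0 / 2 - 1 / 2 : ℝ) * ((2 : ℕ) : ℝ) = -1 := by norm_num
    rw [← Real.rpow_mul_natCast (abs_nonneg _), h3, Real.rpow_neg_one, one_div]
  have h2 : |μ h| ^ 2 / |D.eig h| ≤ ∑' k, |μ k| ^ 2 / |D.eig k| :=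
    hμ.le_tsum h fun _ _ => by positivity
  calc _ = |μ h| ^ 2 / |D.eig h| * ⟪D.basis h, v⟫_ℝ ^ 2 := by
        rw [CoordFamily.diag_apply, mul_pow, h1, mul_pow, sq_abs, coord_apply]
        ring
    _ ≤ _ := by gcongr

theorem hasSum_inner_sq (v : H) : HasSum (fun h => ⟪D.basis h, v⟫_ℝ ^ 2) (‖v‖ ^ 2) := by
  have := D.basis.hasSum_inner_mul_inner v v
  rw [real_inner_self_eq_norm_sq] at this
  refine this.congr_fun fun h => ?_
  rw [sq, real_inner_comm v]

theorem noise_mem {μ : ι → ℝ} (hμ : Summable fun h => |μ h| ^ 2 / |D.eig h|) (v : H) :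
    CoordFamily.diag μ (D.coord v) ∈ D.Hs (0 / 2 - 1 / 2) :=
  Summable.of_nonneg_of_le (fun _ => sq_nonneg _) (D.noise_bound hμ v)
    ((D.hasSum_inner_sq v).summable.mul_left _)

/-- The operator `𝐁 v = (0, ∑ μ_h ⟨e_h, v⟩ e_h)` from `H` to `𝐇_0`. -/
def noiseOp (μ : ι → ℝ) (hμ : Summable fun h => |μ h| ^ 2 / |D.eig h|) : H →L[ℝ] D.Wv 0 :=
  LinearMap.mkContinuous (D.pairMap 0 0 (CoordFamily.diag μ ∘ₗ D.coord)
    (fun _ => (D.Hs _).zero_mem) (D.noise_mem hμ)) (√(∑' k, |μ k| ^ 2 / |D.eig k|)) fun v => by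
      have h0 : 0 ≤ ∑' k, |μ k| ^ 2 / |D.eig k| := tsum_nonneg fun _ => by positivity
      refine le_of_sq_le_sq ?_ (by positivity)
      rw [norm_sq_wave, mul_pow, Real.sq_sqrt h0, fstCoord_pairMap, sndCoord_pairMap,
        ← (D.hasSum_inner_sq v).tsum_eq, ← tsum_mul_left]
      simp only [LinearMap.zero_apply, CoordFamily.zero_apply, mul_zero, ne_eq, OfNat.ofNat_ne_zero,
        not_false_eq_true, zero_pow, tsum_zero, zero_add]
      exact Summable.tsum_le_tsum (D.noise_bound hμ v) (D.noise_mem hμ v)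
        ((D.hasSum_inner_sq v).summable.mul_left _)

theorem fstCoord_noiseOp (μ : ι → ℝ) (hμ : Summable fun h => |μ h| ^ 2 / |D.eig h|) (v : H) :
    D.fstCoord 0 (D.noiseOp μ hμ v) = 0 := D.fstCoord_pairMap _ _ _
theorem sndCoord_noiseOp (μ : ι → ℝ) (hμ : Summable fun h => |μ h| ^ 2 / |D.eig h|) (v : H) :
    D.sndCoord 0 (D.noiseOp μ hμ v) = CoordFamily.diag μ (D.coord v) := D.sndCoord_pairMap _ _ _

end NegDiagonal

/-! ### Cylindrical Wiener processes and the stochastic integral -/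

section Stochastic

variable {Ω : Type*} {m : MeasurableSpace Ω} {T : ℝ}
  {H V : Type*} [NormedAddCommGroup H] [InnerProductSpace ℝ H]
  [NormedAddCommGroup V] [InnerProductSpace ℝ V]

/-- A normal filtration on `[0, T]`: right-continuous, and every `𝔽_t` contains all events of
probability zero. -/
structure IsNormalFiltration (P : Measure Ω) (𝔽 : Filtration (Set.Icc (0 : ℝ) T) m) : Prop where
  rightContinuous : 𝔽.IsRightContinuous
  null_mem : ∀ t (N : Set Ω), MeasurableSet[m] N → P N = 0 → MeasurableSet[𝔽 t] N

/-- `W` is an `Id_H`-cylindrical Wiener process with respect to the filtration `𝔽`, given by the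
real random variables `W t u = ⟨u, W_t⟩`, `u ∈ H`: for all `u` the process `⟨u, W_t⟩` is adapted,
starts in `0`, has continuous paths, and has increments `⟨u, W_t⟩ - ⟨u, W_s⟩` that are independent
of `𝔽_s` and centred Gaussian with variance `(t - s) ‖u‖ ^ 2`; and `⟨u, W_t⟩` is linear in `u`. -/
structure IsCylindricalWiener (P : Measure Ω) (𝔽 : Filtration (Set.Icc (0 : ℝ) T) m)
    (W : Set.Icc (0 : ℝ) T → H → Ω → ℝ) : Prop where
  adapted : ∀ t u, Measurable[𝔽 t] (W t u)
  add : ∀ t u v, W t (u + v) =ᵐ[P] W t u + W t v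
  smul : ∀ t (c : ℝ) u, W t (c • u) =ᵐ[P] c • W t u
  zero : ∀ t : Set.Icc (0 : ℝ) T, (t : ℝ) = 0 → ∀ u, W t u =ᵐ[P] 0
  cont : ∀ u, ∀ᵐ ω ∂P, Continuous fun t => W t u ω
  indep : ∀ s t, s ≤ t → ∀ u,
    Indep (MeasurableSpace.comap (W t u - W s u) inferInstance) (𝔽 s) P
  law : ∀ s t, s ≤ t → ∀ u,
    HasLaw (W t u - W s u) (gaussianReal 0 (((t : ℝ) - s) * ‖u‖ ^ 2).toNNReal) P

/-- A deterministic elementary integrand `∑_k 1_{(a_k, b_k]}(s) ⟨u_k, ·⟩ v_k` on `[0, T]`, that is,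
a step function whose values are operators of finite rank. -/
structure ElementaryIntegrand (T : ℝ) (H V : Type*) where
  n : ℕ
  a : Fin n → Set.Icc (0 : ℝ) T
  b : Fin n → Set.Icc (0 : ℝ) T
  a_le_b : ∀ k, a k ≤ b k
  u : Fin n → H
  v : Fin n → V

/-- The value of an elementary integrand at time `s`. -/
def ElementaryIntegrand.eval (Ψ : ElementaryIntegrand T H V) (s : ℝ) : H →L[ℝ] V :=
  ∑ k, (Set.Ioc (Ψ.a k : ℝ) (Ψ.b k)).indicator
    (fun _ => (innerSL ℝ (Ψ.u k)).smulRight (Ψ.v k)) s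

/-- The stochastic integral `∑_k ⟨u_k, W_{b_k} - W_{a_k}⟩ v_k` of an elementary integrand. -/
def ElementaryIntegrand.integral (Ψ : ElementaryIntegrand T H V)
    (W : Set.Icc (0 : ℝ) T → H → Ω → ℝ) (ω : Ω) : V :=
  ∑ k, (W (Ψ.b k) (Ψ.u k) ω - W (Ψ.a k) (Ψ.u k) ω) • Ψ.v k

/-- The squared Hilbert-Schmidt norm `∑_h ‖L e_h‖ ^ 2` (possibly infinite); it does not depend on
the orthonormal basis. -/
def hsNormSq {ι : Type*} (e : HilbertBasis ι ℝ H) (L : H →L[ℝ] V) : ℝ≥0∞ := ∑' h, ‖L (e h)‖ₑ ^ 2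

/-- `X = ∫_0^T Φ(s) dW_s` almost surely, for a deterministic integrand `Φ` with values in the
Hilbert-Schmidt operators: `X` is the limit in `L^2(P; V)` of the integrals of elementary integrands
which converge to `Φ` in `L^2([0, T]; HS(H, V))`. -/
def IsStochasticIntegral {ι : Type*} (e : HilbertBasis ι ℝ H) (P : Measure Ω)
    (W : Set.Icc (0 : ℝ) T → H → Ω → ℝ) (Φ : ℝ → H →L[ℝ] V) (X : Ω → V) : Prop :=
  ∃ Ψ : ℕ → ElementaryIntegrand T H V,
    Tendsto (fun n => ∫⁻ s in Set.Icc 0 T, hsNormSq e (Φ s - (Ψ n).eval s)) atTop (𝓝 0) ∧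
    Tendsto (fun n => ∫⁻ ω, ‖X ω - (Ψ n).integral W ω‖ₑ ^ 2 ∂P) atTop (𝓝 0)

end Stochastic

end

/-!
For every `I`, the second moment of `𝐗^I` equals `T * ∑ h ∈ I, |μ_h| ^ 2 / |λ_h|`, and the assertions
are immediate consequences: this expression is additive in `I`, and each summand is at least
`(inf |μ| ^ 2) / |λ_h|`, which also bounds the sums of the `1 / |λ_h|`.

The formula is Itô's isometry, `𝔼 ‖𝐗^I‖ ^ 2 = ∫_0^T ‖e^{(T - s)𝐀} 𝐏_I 𝐁‖_HS ^ 2 ds`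
(`IsStochasticIntegral.lintegral_enorm_sq`), with an integrand that is constant in `s`: the wave
operator is skew-symmetric on `𝐇_0` (`NegDiagonal.inner_waveOp_self`), so its semigroup preserves the
norm of vectors of its domain (`IsC0SemigroupGeneratedBy.norm_map_of_skew`), in particular of the
vectors `𝐏_I 𝐁 e_h`, whose squared norm is `|μ_h| ^ 2 / |λ_h|` if `h ∈ I` and `0` otherwise. The
argument uses only that the semigroup is generated by `𝐀`, no explicit formula for it.

Itô's isometry for elementary integrands
(`ElementaryIntegrand.lintegral_enorm_integral_sq`) expands both sides into double sums over the
steps and compares the summands, using `𝔼[⟨u, W_s⟩ ⟨v, W_t⟩] = min s t * ⟨u, v⟩`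
(`IsCylindricalWiener.integral_mul`). It passes to the limit by
`‖x‖ ^ 2 ≤ (1 + ε) ‖y‖ ^ 2 + (1 + ε⁻¹) ‖x - y‖ ^ 2`.
-/

/-! ### Semigroups with skew-symmetric generator -/

theorem IsC0SemigroupGeneratedBy.map_mem_graph {V : Type*} [NormedAddCommGroup V] [NormedSpace ℝ V]
    {S : ℝ → V →L[ℝ] V} {A : V →ₗ.[ℝ] V} (hS : IsC0SemigroupGeneratedBy S A) {x y : V}
    (hxy : (x, y) ∈ A.graph) {t : ℝ} (ht : 0 ≤ t) : (S t x, S t y) ∈ A.graph := by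
  rw [hS.generator] at hxy ⊢
  refine (((S t).continuous.tendsto y).comp hxy).congr' ?_
  filter_upwards [self_mem_nhdsWithin] with δ hδ
  rw [Function.comp_apply, map_smul, map_sub, ← ContinuousLinearMap.comp_apply, ← hS.add t δ ht
    (le_of_lt hδ), add_comm, hS.add δ t (le_of_lt hδ) ht, ContinuousLinearMap.comp_apply]

theorem IsC0SemigroupGeneratedBy.hasDerivWithinAt {V : Type*} [NormedAddCommGroup V]
    [NormedSpace ℝ V] {S : ℝ → V →L[ℝ] V} {A : V →ₗ.[ℝ] V} (hS : IsC0SemigroupGeneratedBy S A)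
    {x y : V} (hxy : (x, y) ∈ A.graph) {t : ℝ} (ht : 0 ≤ t) :
    HasDerivWithinAt (fun s => S s x) (S t y) (Set.Ici t) t := by
  rw [← hasDerivWithinAt_Ioi_iff_Ici, hasDerivWithinAt_iff_tendsto_slope' Set.self_notMem_Ioi]
  have h := (hS.generator _ _).1 (hS.map_mem_graph hxy ht)
  have hsub : Tendsto (fun s : ℝ => s - t) (𝓝[>] t) (𝓝[>] 0) := by
    refine tendsto_nhdsWithin_iff.2 ⟨?_, ?_⟩
    · have : Tendsto (fun s : ℝ => s - t) (𝓝 t) (𝓝 (t - t)) := (continuous_sub_right t).tendsto t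
      rw [sub_self] at this
      exact this.mono_left nhdsWithin_le_nhds
    · filter_upwards [self_mem_nhdsWithin] with s hs
      exact sub_pos.2 (Set.mem_Ioi.1 hs)
  refine (h.comp hsub).congr' ?_
  filter_upwards [self_mem_nhdsWithin] with s hs
  rw [Function.comp_apply, ← ContinuousLinearMap.comp_apply,
    ← hS.add _ _ (sub_nonneg.2 (le_of_lt hs)) ht, sub_add_cancel, slope_def_module]

/-- A skew-symmetric generator conserves energy: the right derivative of `‖S t x‖ ^ 2` is
`2 ⟪S t x, A (S t x)⟫ = 0`. -/
theorem IsC0SemigroupGeneratedBy.norm_map_of_skew {V : Type*} [NormedAddCommGroup V]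
    [InnerProductSpace ℝ V] {S : ℝ → V →L[ℝ] V} {A : V →ₗ.[ℝ] V}
    (hS : IsC0SemigroupGeneratedBy S A) (hA : ∀ x : A.domain, ⟪(x : V), A x⟫_ℝ = 0)
    (x : A.domain) {t : ℝ} (ht : 0 ≤ t) : ‖S t x‖ = ‖(x : V)‖ := by
  have hA' : ∀ {p q : V}, (p, q) ∈ A.graph → ⟪p, q⟫_ℝ = 0 := by
    intro p q hpq
    obtain ⟨z, rfl, rfl⟩ := (LinearPMap.mem_graph_iff _).1 hpq
    exact hA z
  have hx : ((x : V), A x) ∈ A.graph := A.mem_graph x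
  have h := constant_of_has_deriv_right_zero (f := fun s => ‖S s x‖ ^ 2) (a := 0) (b := t)
    (((hS.cont x).mono Set.Icc_subset_Ici_self).norm.pow 2)
    (fun s hs => by
      have := (hS.hasDerivWithinAt hx hs.1).norm_sq
      rwa [hA' (hS.map_mem_graph hx hs.1), mul_zero] at this)
    t ⟨ht, le_rfl⟩
  simpa [hS.zero] using h

/-! ### The stochastic wave integrand -/

namespace NegDiagonal

variable {ι H : Type*} [NormedAddCommGroup H] [InnerProductSpace ℝ H] (D : NegDiagonal ι H)

theorem hasSum_inner_wave (x y : D.Wv 0) : HasSum (fun h => D.fstCoord 0 x h * D.fstCoord 0 y h +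
    |D.eig h|⁻¹ * (D.sndCoord 0 x h * D.sndCoord 0 y h)) ⟪x, y⟫_ℝ := by
  have key : ∀ (r : ℝ) (u v : D.Hs r),
      HasSum (fun h => (|D.eig h| ^ r * u.1 h) * (|D.eig h| ^ r * v.1 h)) ⟪u, v⟫_ℝ := by
    intro r u v
    refine (lp.hasSum_inner (𝕜 := ℝ) (D.HsToLp r u) (D.HsToLp r v)).congr_fun fun h => ?_
    simp [mul_comm]
  rw [WithLp.prod_inner_apply]
  refine ((key _ x.fst y.fst).add (key _ x.snd y.snd)).congr_fun fun h => ?_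
  have h1 : |D.eig h| ^ (0 / 2 - 1 / 2 : ℝ) * |D.eig h| ^ (0 / 2 - 1 / 2 : ℝ) = |D.eig h|⁻¹ := by
    rw [← Real.rpow_add (D.abs_eig_pos h), ← Real.rpow_neg_one]
    norm_num
  have h2 : |D.eig h| ^ (0 / 2 : ℝ) = 1 := by rw [zero_div, Real.rpow_zero]
  simp only [← h1, fstCoord_apply, sndCoord_apply]
  generalize |D.eig h| ^ (0 / 2 - 1 / 2 : ℝ) = q
  rw [h2]
  ring

/-- The wave operator is skew-symmetric on `𝐇_0`. -/
theorem inner_waveOp_self (x : D.waveOp.domain) : ⟪(x : D.Wv 0), D.waveOp x⟫_ℝ = 0 := by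
  refine (D.hasSum_inner_wave x (D.waveOp x)).unique (hasSum_zero.congr_fun fun h => ?_)
  have h1 := (D.abs_eig_pos h).ne'
  rw [waveOp_fst, waveOp_snd, opA, CoordFamily.diag_apply]
  -- Since `λ_h / |λ_h| = -1`, the two components cancel coordinate by coordinate.
  have h2 : D.eig h = -|D.eig h| := by rw [abs_of_neg (D.eig_neg h), neg_neg]
  rw [h2, abs_neg, abs_abs]
  field_simp
  ring

open Classical in
theorem noiseOp_basis_coord {μ : ι → ℝ} (hμ : Summable fun h => |μ h| ^ 2 / |D.eig h|)
    (I : Set ι) (h k : ι) : D.sndCoord 0 (D.projWv I 0 (D.noiseOp μ hμ (D.basis h))) k =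
      if k = h ∧ h ∈ I then μ h else 0 := by
  rw [sndCoord_projWv, sndCoord_noiseOp, CoordFamily.proj, CoordFamily.diag_apply,
    CoordFamily.diag_apply, coord_apply, orthonormal_iff_ite.1 D.basis.orthonormal k h]
  by_cases hk : k = h
  · subst hk
    by_cases hI : k ∈ I <;> simp [hI]
  · simp [hk]

theorem fstCoord_projWv_noiseOp {μ : ι → ℝ} (hμ : Summable fun h => |μ h| ^ 2 / |D.eig h|)
    (I : Set ι) (v : H) : D.fstCoord 0 (D.projWv I 0 (D.noiseOp μ hμ v)) = 0 := by
  rw [fstCoord_projWv, fstCoord_noiseOp, map_zero]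

theorem projWv_noiseOp_basis_mem {μ : ι → ℝ} (hμ : Summable fun h => |μ h| ^ 2 / |D.eig h|)
    (I : Set ι) (h : ι) :
    D.projWv I 0 (D.noiseOp μ hμ (D.basis h)) ∈ D.waveOp.domain := by
  classical
  refine D.mem_waveDomain.2 ⟨?_, ?_⟩
  · rw [fstCoord_projWv_noiseOp]
    exact zero_mem _
  · rw [mem_Hs]
    refine summable_of_ne_finset_zero (s := {h}) fun k hk => ?_
    rw [Finset.mem_singleton] at hk
    simp [noiseOp_basis_coord, hk]

theorem norm_sq_projWv_noiseOp_basis {μ : ι → ℝ}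
    (hμ : Summable fun h => |μ h| ^ 2 / |D.eig h|) (I : Set ι) (h : ι) :
    ‖D.projWv I 0 (D.noiseOp μ hμ (D.basis h))‖ ^ 2 =
      I.indicator (fun h => |μ h| ^ 2 / |D.eig h|) h := by
  classical
  rw [← real_inner_self_eq_norm_sq]
  refine (D.hasSum_inner_wave _ _).unique ((hasSum_ite_eq h _).congr_fun fun k => ?_)
  rw [fstCoord_projWv_noiseOp, noiseOp_basis_coord]
  by_cases hk : k = h
  · subst hk
    by_cases hI : k ∈ I
    · simp [hI]
      ring
    · simp [hI]
  · simp [hk]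

/-- The wave group is isometric, so the squared Hilbert-Schmidt norm of the integrand does not
depend on time. -/
theorem hsNormSq_waveExp {μ : ι → ℝ} (hμ : Summable fun h => |μ h| ^ 2 / |D.eig h|) (I : Set ι)
    {t : ℝ} (ht : 0 ≤ t) :
    hsNormSq D.basis ((D.waveExp t).comp ((D.projWv I 0).comp (D.noiseOp μ hμ))) =
      ENNReal.ofReal (∑' h : I, |μ h| ^ 2 / |D.eig h|) := by
  have hnn : ∀ h, 0 ≤ I.indicator (fun h => |μ h| ^ 2 / |D.eig h|) h :=
    fun h => Set.indicator_nonneg (fun _ _ => by positivity) h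
  rw [tsum_subtype I fun h => |μ h| ^ 2 / |D.eig h|,
    ENNReal.ofReal_tsum_of_nonneg hnn (hμ.indicator I), hsNormSq]
  refine tsum_congr fun h => ?_
  rw [ContinuousLinearMap.comp_apply, ContinuousLinearMap.comp_apply, ← ofReal_norm,
    D.waveExp_spec.norm_map_of_skew D.inner_waveOp_self
      ⟨_, D.projWv_noiseOp_basis_mem hμ I h⟩ ht, ← ENNReal.ofReal_pow (norm_nonneg _),
    norm_sq_projWv_noiseOp_basis]

end NegDiagonal

/-! ### Covariances of a cylindrical Wiener process -/

section Stochastic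

variable {Ω : Type*} {m : MeasurableSpace Ω} {T : ℝ}
  {H V : Type*} [NormedAddCommGroup H] [InnerProductSpace ℝ H]
  [NormedAddCommGroup V] [InnerProductSpace ℝ V]
  {P : Measure Ω} {𝔽 : Filtration (Set.Icc (0 : ℝ) T) m} {W : Set.Icc (0 : ℝ) T → H → Ω → ℝ}

namespace IsCylindricalWiener

theorem measurable (hW : IsCylindricalWiener P 𝔽 W) (t : Set.Icc (0 : ℝ) T) (u : H) :
    Measurable (W t u) :=
  (hW.adapted t u).mono (𝔽.le t) le_rfl

theorem memLp_increment (hW : IsCylindricalWiener P 𝔽 W) {s t : Set.Icc (0 : ℝ) T} (hst : s ≤ t)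
    (u : H) : MemLp (W t u - W s u) 2 P :=
  MemLp.comp_of_map (g := id) (by
    rw [(hW.law s t hst u).map_eq]
    exact memLp_id_gaussianReal 2) (hW.law s t hst u).aemeasurable

theorem integral_increment (hW : IsCylindricalWiener P 𝔽 W) {s t : Set.Icc (0 : ℝ) T}
    (hst : s ≤ t) (u : H) : ∫ ω, (W t u - W s u) ω ∂P = 0 := by
  rw [(hW.law s t hst u).integral_eq, integral_id_gaussianReal]

theorem ae_eq_increment (hW : IsCylindricalWiener P 𝔽 W) (hT : 0 ≤ T) (t : Set.Icc (0 : ℝ) T)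
    (u : H) : W t u =ᵐ[P] W t u - W ⟨0, le_rfl, hT⟩ u := by
  filter_upwards [hW.zero ⟨0, le_rfl, hT⟩ rfl u] with ω hω
  simp [hω]

theorem memLp (hW : IsCylindricalWiener P 𝔽 W) (t : Set.Icc (0 : ℝ) T) (u : H) :
    MemLp (W t u) 2 P :=
  (memLp_congr_ae (hW.ae_eq_increment (t.2.1.trans t.2.2) t u)).2 (hW.memLp_increment t.2.1 u)

theorem integrable_mul (hW : IsCylindricalWiener P 𝔽 W) (s t : Set.Icc (0 : ℝ) T) (u v : H) :
    Integrable (fun ω => W s u ω * W t v ω) P :=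
  (hW.memLp s u).integrable_mul (hW.memLp t v)

theorem integral_sq (hW : IsCylindricalWiener P 𝔽 W) (t : Set.Icc (0 : ℝ) T) (u : H) :
    ∫ ω, W t u ω * W t u ω ∂P = t * ‖u‖ ^ 2 := by
  have hT : 0 ≤ T := t.2.1.trans t.2.2
  have hle : (⟨0, le_rfl, hT⟩ : Set.Icc (0 : ℝ) T) ≤ t := t.2.1
  have h1 := (hW.law _ t hle u).variance_eq
  rw [variance_id_gaussianReal, variance_eq_integral (hW.law _ t hle u).aemeasurable,
    hW.integral_increment hle u, Real.coe_toNNReal _ (by have := t.2.1; simp; positivity)] at h1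
  simp only [sub_zero] at h1
  rw [← h1]
  refine integral_congr_ae ?_
  filter_upwards [hW.ae_eq_increment hT t u] with ω hω
  rw [← hω, sq]

/-- By polarization: `W t` is almost surely additive. -/
theorem integral_mul_same (hW : IsCylindricalWiener P 𝔽 W) (t : Set.Icc (0 : ℝ) T) (u v : H) :
    ∫ ω, W t u ω * W t v ω ∂P = t * ⟪u, v⟫_ℝ := by
  have h1 := hW.integral_sq t (u + v)
  have h2 : ∫ ω, W t (u + v) ω * W t (u + v) ω ∂P =
      ∫ ω, W t u ω * W t u ω + 2 * (W t u ω * W t v ω) + W t v ω * W t v ω ∂P := by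
    refine integral_congr_ae ?_
    filter_upwards [hW.add t u v] with ω hω
    rw [hω, Pi.add_apply]
    ring
  have hi := (hW.integrable_mul t t u v).const_mul 2
  rw [h2, integral_add (f := fun ω => W t u ω * W t u ω + 2 * (W t u ω * W t v ω))
    ((hW.integrable_mul t t u u).add hi) (hW.integrable_mul t t v v),
    integral_add (hW.integrable_mul t t u u) hi, integral_const_mul, hW.integral_sq,
    hW.integral_sq, norm_add_sq_real] at h1
  linarith

theorem integral_mul_of_le [IsProbabilityMeasure P] (hW : IsCylindricalWiener P 𝔽 W)
    {s t : Set.Icc (0 : ℝ) T} (hst : s ≤ t) (u v : H) : ∫ ω, W s u ω * W t v ω ∂P = s * ⟪u, v⟫_ℝ := by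
  -- Write `W t v` as `W s v` plus an increment, which is centred and independent of `W s u`.
  have hind : IndepFun (W t v - W s v) (W s u) P :=
    (IndepFun_iff_Indep _ _ _).2 (indep_of_indep_of_le_right (hW.indep s t hst v)
      (hW.adapted s u).comap_le)
  have h0 := hind.integral_mul_eq_mul_integral
    (hW.memLp_increment hst v).aestronglyMeasurable (hW.memLp s u).aestronglyMeasurable
  rw [hW.integral_increment hst v, zero_mul] at h0
  have h1 : ∀ ω, W s u ω * W t v ω = ((W t v - W s v) * W s u) ω + W s u ω * W s v ω := by
    intro ω
    simp only [Pi.mul_apply, Pi.sub_apply]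
    ring
  simp_rw [h1]
  rw [integral_add ((hW.memLp_increment hst v).integrable_mul (hW.memLp s u))
    (hW.integrable_mul s s u v), h0, zero_add, hW.integral_mul_same]

/-- The covariance function of a cylindrical Wiener process. -/
theorem integral_mul [IsProbabilityMeasure P] (hW : IsCylindricalWiener P 𝔽 W)
    (s t : Set.Icc (0 : ℝ) T) (u v : H) :
    ∫ ω, W s u ω * W t v ω ∂P = min (s : ℝ) t * ⟪u, v⟫_ℝ := by
  rcases le_total s t with h | h
  · rw [min_eq_left (by exact_mod_cast h), hW.integral_mul_of_le h]
  · simp_rw [mul_comm (W s u _)]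
    rw [min_eq_right (by exact_mod_cast h), hW.integral_mul_of_le h, real_inner_comm]

/-- The identity behind Itô's isometry: the covariance of two increments is the length of the
overlap of the two time intervals, times the inner product. -/
theorem integral_increment_mul_increment [IsProbabilityMeasure P] (hW : IsCylindricalWiener P 𝔽 W)
    {a b c d : Set.Icc (0 : ℝ) T} (hab : a ≤ b) (hcd : c ≤ d) (u v : H) :
    ∫ ω, (W b u ω - W a u ω) * (W d v ω - W c v ω) ∂P =
      volume.real (Set.Ioc (a : ℝ) b ∩ Set.Ioc (c : ℝ) d) * ⟪u, v⟫_ℝ := by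
  have h1 : ∀ ω, (W b u ω - W a u ω) * (W d v ω - W c v ω) =
      W b u ω * W d v ω - W b u ω * W c v ω - (W a u ω * W d v ω - W a u ω * W c v ω) :=
    fun ω => by ring
  simp_rw [h1]
  have hi := hW.integrable_mul
  rw [integral_sub (f := fun ω => W b u ω * W d v ω - W b u ω * W c v ω)
    (g := fun ω => W a u ω * W d v ω - W a u ω * W c v ω)
    ((hi _ _ _ _).sub (hi _ _ _ _)) ((hi _ _ _ _).sub (hi _ _ _ _)),
    integral_sub (hi _ _ _ _) (hi _ _ _ _), integral_sub (hi _ _ _ _) (hi _ _ _ _),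
    hW.integral_mul, hW.integral_mul, hW.integral_mul, hW.integral_mul, Set.Ioc_inter_Ioc,
    Real.volume_real_Ioc]
  have hab : (a : ℝ) ≤ b := hab
  have hcd : (c : ℝ) ≤ d := hcd
  have h2 : min (b : ℝ) d - min (b : ℝ) c - (min (a : ℝ) d - min (a : ℝ) c) =
      max (min (b : ℝ) d - max (a : ℝ) c) 0 := by
    grind
  rw [← h2]
  ring

end IsCylindricalWiener

/-! ### Itô's isometry -/

theorem hsNormSq_eq_ofReal {ι : Type*} {e : HilbertBasis ι ℝ H} {L : H →L[ℝ] V} {x : ℝ}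
    (h : HasSum (fun i => ‖L (e i)‖ ^ 2) x) : hsNormSq e L = ENNReal.ofReal x := by
  rw [← h.tsum_eq, ENNReal.ofReal_tsum_of_nonneg (fun _ => sq_nonneg _) h.summable, hsNormSq]
  exact tsum_congr fun i => by rw [← ofReal_norm, ENNReal.ofReal_pow (norm_nonneg _)]

namespace ElementaryIntegrand

variable (Ψ : ElementaryIntegrand T H V)

/-- The squared Hilbert-Schmidt norm of the step function, as a double sum over its steps, by
Parseval's identity for `⟪u_k, u_l⟫`. -/
theorem hasSum_norm_eval_sq {ι : Type*} (e : HilbertBasis ι ℝ H) (s : ℝ) :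
    HasSum (fun i => ‖Ψ.eval s (e i)‖ ^ 2) (∑ k, ∑ l,
      (Set.Ioc (Ψ.a k : ℝ) (Ψ.b k) ∩ Set.Ioc (Ψ.a l : ℝ) (Ψ.b l)).indicator 1 s *
        (⟪Ψ.u k, Ψ.u l⟫_ℝ * ⟪Ψ.v k, Ψ.v l⟫_ℝ)) := by
  have h : Ψ.eval s = ∑ k, (Set.Ioc (Ψ.a k : ℝ) (Ψ.b k)).indicator (1 : ℝ → ℝ) s •
      (innerSL ℝ (Ψ.u k)).smulRight (Ψ.v k) := by
    refine Finset.sum_congr rfl fun k _ => ?_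
    by_cases hs : s ∈ Set.Ioc (Ψ.a k : ℝ) (Ψ.b k) <;> simp [hs]
  have h1 : ∀ i, ‖Ψ.eval s (e i)‖ ^ 2 = ∑ k, ∑ l,
      (Set.Ioc (Ψ.a k : ℝ) (Ψ.b k) ∩ Set.Ioc (Ψ.a l : ℝ) (Ψ.b l)).indicator 1 s *
        (⟪Ψ.u k, e i⟫_ℝ * ⟪e i, Ψ.u l⟫_ℝ * ⟪Ψ.v k, Ψ.v l⟫_ℝ) := by
    intro i
    rw [← real_inner_self_eq_norm_sq, h]
    simp only [sum_apply, smul_apply, ContinuousLinearMap.smulRight_apply, innerSL_apply_apply,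
      sum_inner, inner_sum, real_inner_smul_left, real_inner_smul_right, Set.inter_indicator_one,
      Pi.mul_apply]
    refine Finset.sum_congr rfl fun k _ => Finset.sum_congr rfl fun l _ => ?_
    rw [real_inner_comm (Ψ.u l), real_inner_comm (Ψ.v k)]
    ring
  simp_rw [h1]
  exact hasSum_sum fun k _ => hasSum_sum fun l _ =>
    ((e.hasSum_inner_mul_inner (Ψ.u k) (Ψ.u l)).mul_right _).mul_left _

theorem measurable_hsNormSq_eval {ι : Type*} (e : HilbertBasis ι ℝ H) :
    Measurable fun s => hsNormSq e (Ψ.eval s) := by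
  simp_rw [fun s => hsNormSq_eq_ofReal (Ψ.hasSum_norm_eval_sq e s)]
  refine (Finset.measurable_fun_sum _ fun k _ => Finset.measurable_fun_sum _ fun l _ =>
    Measurable.mul_const ?_ _).ennreal_ofReal
  exact measurable_one.indicator (measurableSet_Ioc.inter measurableSet_Ioc)

theorem lintegral_hsNormSq_eval {ι : Type*} (e : HilbertBasis ι ℝ H) :
    ∫⁻ s in Set.Icc 0 T, hsNormSq e (Ψ.eval s) = ENNReal.ofReal (∑ k, ∑ l,
      volume.real (Set.Ioc (Ψ.a k : ℝ) (Ψ.b k) ∩ Set.Ioc (Ψ.a l : ℝ) (Ψ.b l)) *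
        (⟪Ψ.u k, Ψ.u l⟫_ℝ * ⟪Ψ.v k, Ψ.v l⟫_ℝ)) := by
  have hi : ∀ k l, Integrable (fun s : ℝ =>
      (Set.Ioc (Ψ.a k : ℝ) (Ψ.b k) ∩ Set.Ioc (Ψ.a l : ℝ) (Ψ.b l)).indicator (1 : ℝ → ℝ) s *
        (⟪Ψ.u k, Ψ.u l⟫_ℝ * ⟪Ψ.v k, Ψ.v l⟫_ℝ)) (volume.restrict (Set.Icc 0 T)) := fun k l =>
    ((integrable_const (1 : ℝ)).indicator (measurableSet_Ioc.inter measurableSet_Ioc)).mul_const _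
  simp_rw [fun s => hsNormSq_eq_ofReal (Ψ.hasSum_norm_eval_sq e s)]
  rw [← ofReal_integral_eq_lintegral_ofReal
    (integrable_finsetSum _ fun k _ => integrable_finsetSum _ fun l _ => hi k l)]
  · congr 1
    rw [integral_finsetSum _ fun k _ => integrable_finsetSum _ fun l _ => hi k l]
    refine Finset.sum_congr rfl fun k _ => ?_
    rw [integral_finsetSum _ fun l _ => hi k l]
    refine Finset.sum_congr rfl fun l _ => ?_
    rw [integral_mul_const, integral_indicator_one (measurableSet_Ioc.inter measurableSet_Ioc),
      measureReal_restrict_apply (measurableSet_Ioc.inter measurableSet_Ioc),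
      Set.inter_eq_left.2 ((Set.inter_subset_left.trans Set.Ioc_subset_Icc_self).trans
        (Set.Icc_subset_Icc (Ψ.a k).2.1 (Ψ.b k).2.2))]
  · exact .of_forall fun s => (Ψ.hasSum_norm_eval_sq e s).nonneg fun _ => sq_nonneg _

theorem stronglyMeasurable_integral (hW : IsCylindricalWiener P 𝔽 W) :
    StronglyMeasurable (Ψ.integral W) := by
  unfold ElementaryIntegrand.integral
  refine Finset.stronglyMeasurable_fun_sum _ fun k _ => ?_
  exact ((hW.measurable _ _).sub (hW.measurable _ _)).stronglyMeasurable.smul_const _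

/-- Itô's isometry for elementary integrands. -/
theorem lintegral_enorm_integral_sq [IsProbabilityMeasure P] (hW : IsCylindricalWiener P 𝔽 W)
    {ι : Type*} (e : HilbertBasis ι ℝ H) :
    ∫⁻ ω, ‖Ψ.integral W ω‖ₑ ^ 2 ∂P = ∫⁻ s in Set.Icc 0 T, hsNormSq e (Ψ.eval s) := by
  have h1 : ∀ ω, ‖Ψ.integral W ω‖ ^ 2 = ∑ k, ∑ l,
      (W (Ψ.b k) (Ψ.u k) ω - W (Ψ.a k) (Ψ.u k) ω) *
        (W (Ψ.b l) (Ψ.u l) ω - W (Ψ.a l) (Ψ.u l) ω) * ⟪Ψ.v k, Ψ.v l⟫_ℝ := by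
    intro ω
    rw [← real_inner_self_eq_norm_sq]
    simp only [ElementaryIntegrand.integral, sum_inner, inner_sum, real_inner_smul_left,
      real_inner_smul_right]
    exact Finset.sum_congr rfl fun k _ => Finset.sum_congr rfl fun l _ => by
      rw [real_inner_comm (Ψ.v k)]
      ring
  have hi : ∀ k l, Integrable (fun ω => (W (Ψ.b k) (Ψ.u k) ω - W (Ψ.a k) (Ψ.u k) ω) *
        (W (Ψ.b l) (Ψ.u l) ω - W (Ψ.a l) (Ψ.u l) ω) * ⟪Ψ.v k, Ψ.v l⟫_ℝ) P := fun k l =>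
    ((hW.memLp_increment (Ψ.a_le_b k) _).integrable_mul
      (hW.memLp_increment (Ψ.a_le_b l) _)).mul_const _
  have hint : Integrable (fun ω => ‖Ψ.integral W ω‖ ^ 2) P := by
    simp_rw [h1]
    exact integrable_finsetSum _ fun k _ => integrable_finsetSum _ fun l _ => hi k l
  simp_rw [← ofReal_norm, ← ENNReal.ofReal_pow (norm_nonneg _)]
  rw [← ofReal_integral_eq_lintegral_ofReal hint (.of_forall fun _ => sq_nonneg _),
    lintegral_hsNormSq_eval]
  simp_rw [h1]
  rw [integral_finsetSum _ fun k _ => integrable_finsetSum _ fun l _ => hi k l]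
  congr 1
  refine Finset.sum_congr rfl fun k _ => ?_
  rw [integral_finsetSum _ fun l _ => hi k l]
  refine Finset.sum_congr rfl fun l _ => ?_
  rw [integral_mul_const, hW.integral_increment_mul_increment (Ψ.a_le_b k) (Ψ.a_le_b l), mul_assoc]

end ElementaryIntegrand

/-- Substitute for the triangle inequality in `L^2` that can be summed and integrated without any
measurability of the difference. -/
theorem enorm_sq_le_add {V : Type*} [SeminormedAddCommGroup V] (x y : V) {ε : ℝ≥0} (hε : 0 < ε) :
    ‖x‖ₑ ^ 2 ≤ ((1 + ε : ℝ≥0) : ℝ≥0∞) * ‖y‖ₑ ^ 2 +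
      ((1 + ε⁻¹ : ℝ≥0) : ℝ≥0∞) * ‖x - y‖ₑ ^ 2 := by
  simp only [enorm_eq_nnnorm]
  norm_cast
  rw [← NNReal.coe_le_coe]
  push_cast
  have h1 : ‖x‖ ≤ ‖y‖ + ‖x - y‖ := by
    simpa using norm_add_le y (x - y)
  have hε' : (0 : ℝ) < ε := hε
  have h2 : (0 : ℝ) ≤ (ε : ℝ)⁻¹ * (ε * ‖y‖ - ‖x - y‖) ^ 2 := by positivity
  have h3 : (ε : ℝ)⁻¹ * (ε * ‖y‖ - ‖x - y‖) ^ 2 =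
      ε * ‖y‖ ^ 2 - 2 * ‖y‖ * ‖x - y‖ + (ε : ℝ)⁻¹ * ‖x - y‖ ^ 2 := by
    field_simp
    ring
  have h4 : ‖x‖ ^ 2 ≤ (‖y‖ + ‖x - y‖) ^ 2 := pow_le_pow_left₀ (norm_nonneg _) h1 2
  nlinarith

theorem hsNormSq_le_add {ι : Type*} (e : HilbertBasis ι ℝ H) (L M : H →L[ℝ] V) {ε : ℝ≥0}
    (hε : 0 < ε) : hsNormSq e L ≤ ((1 + ε : ℝ≥0) : ℝ≥0∞) * hsNormSq e M +
      ((1 + ε⁻¹ : ℝ≥0) : ℝ≥0∞) * hsNormSq e (L - M) := by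
  simp only [hsNormSq]
  rw [← ENNReal.tsum_mul_left, ← ENNReal.tsum_mul_left, ← ENNReal.tsum_add]
  exact ENNReal.tsum_le_tsum fun h => enorm_sq_le_add _ _ hε

theorem hsNormSq_sub_comm {ι : Type*} (e : HilbertBasis ι ℝ H) (L M : H →L[ℝ] V) :
    hsNormSq e (L - M) = hsNormSq e (M - L) := by
  refine tsum_congr fun h => ?_
  rw [sub_apply, sub_apply, ← enorm_neg, neg_sub]

theorem lintegral_le_add {α : Type*} {_ : MeasurableSpace α} {ν : Measure α} {f g d : α → ℝ≥0∞}
    {p q : ℝ≥0} (hg : AEMeasurable g ν) (h : ∀ᵐ x ∂ν, f x ≤ p * g x + q * d x) :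
    ∫⁻ x, f x ∂ν ≤ p * ∫⁻ x, g x ∂ν + q * ∫⁻ x, d x ∂ν := by
  refine (lintegral_mono_ae h).trans (le_of_eq ?_)
  rw [lintegral_add_left' (hg.const_mul _), lintegral_const_mul' _ _ ENNReal.coe_ne_top,
    lintegral_const_mul' _ _ ENNReal.coe_ne_top]

/-- If the square roots of `a` and `b n`, and of `b n` and `c`, have distances tending to zero,
expressed without square roots by inequalities
`(x + y) ^ 2 ≤ (1 + ε) x ^ 2 + (1 + ε⁻¹) y ^ 2`, then `a ≤ c`. -/
theorem le_of_forall_le_add {a c : ℝ≥0∞} {b d d' : ℕ → ℝ≥0∞}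
    (hab : ∀ ε : ℝ≥0, 0 < ε → ∀ n, a ≤ (1 + ε : ℝ≥0) * b n + (1 + ε⁻¹ : ℝ≥0) * d n)
    (hbc : ∀ ε : ℝ≥0, 0 < ε → ∀ n, b n ≤ (1 + ε : ℝ≥0) * c + (1 + ε⁻¹ : ℝ≥0) * d' n)
    (hd : Tendsto d atTop (𝓝 0)) (hd' : Tendsto d' atTop (𝓝 0)) : a ≤ c := by
  have h1 : ∀ ε : ℝ≥0, 0 < ε → a ≤ ((1 + ε) * (1 + ε) : ℝ≥0) * c := by
    intro ε hε
    have hlim : Tendsto (fun n => ((1 + ε : ℝ≥0) : ℝ≥0∞) *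
        ((1 + ε : ℝ≥0) * c + (1 + ε⁻¹ : ℝ≥0) * d' n) + (1 + ε⁻¹ : ℝ≥0) * d n) atTop
        (𝓝 (((1 + ε : ℝ≥0) : ℝ≥0∞) * ((1 + ε : ℝ≥0) * c + (1 + ε⁻¹ : ℝ≥0) * 0) +
          (1 + ε⁻¹ : ℝ≥0) * 0)) := by
      have hm : ∀ {f : ℕ → ℝ≥0∞} {x : ℝ≥0∞} (p : ℝ≥0), Tendsto f atTop (𝓝 x) →
          Tendsto (fun n => (p : ℝ≥0∞) * f n) atTop (𝓝 (p * x)) := fun p hf =>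
        ENNReal.Tendsto.const_mul hf (.inr ENNReal.coe_ne_top)
      exact (hm _ ((hm _ hd').const_add _)).add (hm _ hd)
    have := ge_of_tendsto' hlim fun n => (hab ε hε n).trans (by gcongr; exact hbc ε hε n)
    rwa [mul_zero, add_zero, add_zero, ← mul_assoc, ← ENNReal.coe_mul] at this
  have h2 : Tendsto (fun ε : ℝ≥0 => (((1 + ε) * (1 + ε) : ℝ≥0) : ℝ≥0∞) * c) (𝓝[>] 0) (𝓝 c) := by
    have h3 : Tendsto (fun ε : ℝ≥0 => (((1 + ε) * (1 + ε) : ℝ≥0) : ℝ≥0∞)) (𝓝 0) (𝓝 1) := by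
      have : Continuous fun ε : ℝ≥0 => (((1 + ε) * (1 + ε) : ℝ≥0) : ℝ≥0∞) :=
        ENNReal.continuous_coe.comp (by fun_prop)
      simpa using this.tendsto 0
    simpa using ENNReal.Tendsto.mul_const (h3.mono_left nhdsWithin_le_nhds) (.inl one_ne_zero)
  exact ge_of_tendsto h2 (by filter_upwards [self_mem_nhdsWithin] with ε hε using h1 ε hε)

/-- Itô's isometry for deterministic integrands. Only the scalar function `s ↦ hsNormSq e (Φ s)`
has to be measurable, since one measurable summand suffices for additivity of `∫⁻`. -/
theorem IsStochasticIntegral.lintegral_enorm_sq [IsProbabilityMeasure P]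
    (hW : IsCylindricalWiener P 𝔽 W) {ι : Type*} {e : HilbertBasis ι ℝ H} {Φ : ℝ → H →L[ℝ] V}
    {X : Ω → V} (hX : IsStochasticIntegral e P W Φ X) (hXm : AEStronglyMeasurable X P)
    (hΦ : AEMeasurable (fun s => hsNormSq e (Φ s)) (volume.restrict (Set.Icc 0 T))) :
    ∫⁻ ω, ‖X ω‖ₑ ^ 2 ∂P = ∫⁻ s in Set.Icc 0 T, hsNormSq e (Φ s) := by
  obtain ⟨Ψ, h1, h2⟩ := hX
  have hXm' : AEMeasurable (fun ω => ‖X ω‖ₑ ^ 2) P := hXm.enorm.pow_const 2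
  have hΨm : ∀ n, AEMeasurable (fun ω => ‖(Ψ n).integral W ω‖ₑ ^ 2) P := fun n =>
    ((Ψ n).stronglyMeasurable_integral hW).aestronglyMeasurable.enorm.pow_const 2
  have hIto := fun n => (Ψ n).lintegral_enorm_integral_sq hW e
  -- Both sides are the limit of the common value `b n` of the two sides for `Ψ n`.
  refine le_antisymm
    (le_of_forall_le_add (b := fun n => ∫⁻ s in Set.Icc 0 T, hsNormSq e ((Ψ n).eval s))
      (fun ε hε n => ?_) (fun ε hε n => ?_) h2 h1)
    (le_of_forall_le_add (b := fun n => ∫⁻ s in Set.Icc 0 T, hsNormSq e ((Ψ n).eval s))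
      (fun ε hε n => ?_) (fun ε hε n => ?_) h1 h2)
  · rw [← hIto]
    exact lintegral_le_add (hΨm n) (.of_forall fun ω => enorm_sq_le_add _ _ hε)
  · exact lintegral_le_add hΦ (.of_forall fun s =>
      (hsNormSq_le_add e _ (Φ s) hε).trans_eq (by rw [hsNormSq_sub_comm e (Φ s) ((Ψ n).eval s)]))
  · exact lintegral_le_add ((Ψ n).measurable_hsNormSq_eval e).aemeasurable
      (.of_forall fun s => hsNormSq_le_add e _ _ hε)
  · rw [← hIto]
    exact lintegral_le_add hXm' (.of_forall fun ω =>
      (enorm_sq_le_add _ (X ω) hε).trans_eq (by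
        rw [← enorm_neg (X ω - (Ψ n).integral W ω), neg_sub]))

end Stochastic

/-! ### Second moments of the stochastic convolution -/

/-- The second moment of the stochastic convolution: each mode `h ∈ I` contributes
`T * |μ_h| ^ 2 / |λ_h|`. -/
theorem IsStochasticIntegral.lintegral_enorm_sq_wave {H : Type*} [NormedAddCommGroup H]
    [InnerProductSpace ℝ H] {Ω : Type*} {m : MeasurableSpace Ω} {P : Measure Ω}
    [IsProbabilityMeasure P] {T : ℝ} {𝔽 : Filtration (Set.Icc (0 : ℝ) T) m}
    {W : Set.Icc (0 : ℝ) T → H → Ω → ℝ} (hW : IsCylindricalWiener P 𝔽 W) {ι : Type*}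
    {D : NegDiagonal ι H} {μ : ι → ℝ} {hμ : Summable fun h => |μ h| ^ 2 / |D.eig h|} {I : Set ι}
    {X : Ω → D.Wv 0} (hXm : StronglyMeasurable X)
    (hX : IsStochasticIntegral D.basis P W
      (fun s => (D.waveExp (T - s)).comp ((D.projWv I 0).comp (D.noiseOp μ hμ))) X) :
    ∫⁻ ω, ‖X ω‖ₑ ^ 2 ∂P = ENNReal.ofReal (T * ∑' h : I, |μ h| ^ 2 / |D.eig h|) := by
  have hc : 0 ≤ ∑' h : I, |μ h| ^ 2 / |D.eig h| := tsum_nonneg fun _ => by positivity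
  have hconst : ∀ s ∈ Set.Icc 0 T, hsNormSq D.basis
      ((D.waveExp (T - s)).comp ((D.projWv I 0).comp (D.noiseOp μ hμ))) =
        ENNReal.ofReal (∑' h : I, |μ h| ^ 2 / |D.eig h|) :=
    fun s hs => D.hsNormSq_waveExp hμ I (sub_nonneg.2 hs.2)
  rw [hX.lintegral_enorm_sq hW hXm.aestronglyMeasurable, setLIntegral_congr_fun measurableSet_Icc
    hconst, setLIntegral_const, Real.volume_Icc, sub_zero, ← ENNReal.ofReal_mul hc, mul_comm]
  exact (aemeasurable_const (b := ENNReal.ofReal (∑' h : I, |μ h| ^ 2 / |D.eig h|))).congr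
    (.symm (ae_restrict_of_forall_mem measurableSet_Icc hconst))

theorem proposition2p5
    {H : Type*} [NormedAddCommGroup H] [InnerProductSpace ℝ H] [CompleteSpace H]
    [TopologicalSpace.SeparableSpace H]
    {Ω : Type*} {m : MeasurableSpace Ω} (P : Measure Ω) [IsProbabilityMeasure P]
    (T : ℝ) (hT : 0 < T)
    (𝔽 : Filtration (Set.Icc (0 : ℝ) T) m) (h𝔽 : IsNormalFiltration P 𝔽)
    (W : Set.Icc (0 : ℝ) T → H → Ω → ℝ) (hW : IsCylindricalWiener P 𝔽 W)
    {ι : Type*} (D : NegDiagonal ι H)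
    (μ : ι → ℝ) (hμ : Summable fun h => |μ h| ^ 2 / |D.eig h|)
    (X : Set ι → Ω → D.Wv 0)
    (hX_meas : ∀ I, StronglyMeasurable (X I))
    (hX_range : ∀ I ω, X I ω ∈ Set.range (D.projWv I 0))
    (hX : ∀ I, IsStochasticIntegral D.basis P W
      (fun s => (D.waveExp (T - s)).comp ((D.projWv I 0).comp (D.noiseOp μ hμ))) (X I))
    (hμ_inf : 0 < ⨅ h, |μ h|) :
    (∀ I, MemLp (X I) 2 P) ∧
    ∀ I : Set ι, I ≠ Set.univ →
      (∫ ω, ‖X Set.univ ω‖ ^ 2 ∂P) - (∫ ω, ‖X I ω‖ ^ 2 ∂P) =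
          ∫ ω, ‖X (Set.univ \ I) ω‖ ^ 2 ∂P ∧
      Summable (fun h : ↥(Set.univ \ I) => 1 / |D.eig h|) ∧
      T * (⨅ h, |μ h| ^ 2) * ∑' h : ↥(Set.univ \ I), 1 / |D.eig h| ≤
          ∫ ω, ‖X (Set.univ \ I) ω‖ ^ 2 ∂P ∧
      0 < T * (⨅ h, |μ h| ^ 2) * ∑' h : ↥(Set.univ \ I), 1 / |D.eig h| := by
  have hlint := fun I => (hX I).lintegral_enorm_sq_wave hW (hX_meas I)
  have hint : ∀ I, ∫ ω, ‖X I ω‖ ^ 2 ∂P = T * ∑' h : I, |μ h| ^ 2 / |D.eig h| := by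
    intro I
    have hc : 0 ≤ ∑' h : I, |μ h| ^ 2 / |D.eig h| := tsum_nonneg fun _ => by positivity
    rw [integral_eq_lintegral_of_nonneg_ae (.of_forall fun _ => sq_nonneg _)
      ((hX_meas I).norm.pow 2).aestronglyMeasurable]
    -- The value is finite, so passing between `∫` and `∫⁻` loses nothing.
    simp_rw [ENNReal.ofReal_pow (norm_nonneg _), ofReal_norm]
    rw [hlint, ENNReal.toReal_ofReal (mul_nonneg hT.le hc)]
  refine ⟨fun I => ⟨(hX_meas I).aestronglyMeasurable, ?_⟩, fun I hI => ?_⟩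
  · rw [eLpNorm_lt_top_iff_lintegral_rpow_enorm_lt_top two_ne_zero ENNReal.ofNat_ne_top]
    simp only [ENNReal.toReal_ofNat, ENNReal.rpow_ofNat]
    rw [hlint]
    exact ENNReal.ofReal_lt_top
  obtain ⟨k, hk⟩ := (Set.ne_univ_iff_exists_notMem I).1 hI
  have : Nonempty ι := ⟨k⟩
  have hbdd : ∀ p : ι → ℝ, (∀ h, 0 ≤ p h) → BddBelow (Set.range p) := fun p hp =>
    ⟨0, Set.forall_mem_range.2 hp⟩
  have hinf_le : ∀ h, ⨅ h, |μ h| ^ 2 ≤ |μ h| ^ 2 := ciInf_le (hbdd _ fun _ => by positivity)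
  have hinf : 0 < ⨅ h, |μ h| ^ 2 :=
    (pow_pos hμ_inf 2).trans_le (le_ciInf fun h =>
      pow_le_pow_left₀ hμ_inf.le (ciInf_le (hbdd _ fun _ => abs_nonneg _) h) 2)
  have hle : ∀ h, (⨅ h, |μ h| ^ 2) * (1 / |D.eig h|) ≤ |μ h| ^ 2 / |D.eig h| := fun h => by
    rw [mul_one_div]
    exact div_le_div_of_nonneg_right (hinf_le h) (abs_nonneg _)
  have hsum : Summable fun h => 1 / |D.eig h| :=
    (summable_mul_left_iff hinf.ne').1
      (hμ.of_nonneg_of_le (fun h => by have := hinf.le; positivity) hle)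
  have hsumI := hsum.subtype (Set.univ \ I)
  refine ⟨?_, hsumI, ?_, ?_⟩
  · rw [hint, hint, hint, ← Set.compl_eq_univ_sdiff, tsum_univ fun h => |μ h| ^ 2 / |D.eig h|,
      ← hμ.tsum_subtype_add_tsum_subtype_compl I]
    ring
  · rw [hint, mul_assoc, ← tsum_mul_left]
    exact mul_le_mul_of_nonneg_left
      ((hsumI.mul_left _).tsum_le_tsum (fun h => hle h) (hμ.subtype _)) hT.le
  · exact mul_pos (mul_pos hT hinf) (hsumI.tsum_pos
      (fun h => one_div_nonneg.2 (abs_nonneg _)) ⟨k, trivial, hk⟩ (one_div_pos.2 (D.abs_eig_pos k)))
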